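/- Let $E$ be a locally compact Polish space, $E^\Delta$ its one-point compactification ($E^\Delta=E$ if $E$ is compact), $C_\Delta(E^k)$ the space of restrictions to $E^k$ of functions in $C((E^\Delta)^k)$ with the supremum norm, and $\widehat C_\Delta(E^k)$ its subspace of symmetric functions. Let $M(E)\supseteq M_1(E)$ be the finite signed measures and the probability measures on $E$, the latter with the topology of weak convergence, and write $\langle g,\nu^k\rangle=\int_{E^k} g\,d\nu^{\otimes k}$. Let $P$ be the linear span of the functions $\nu\mapsto\langle g,\nu^k\rangle$ on $M(E)$ with $k\ge 0$, $g\in\widehat C_\Delta(E^k)$. Let $D\subseteq C_\Delta(E)$ be a dense linear subspace containing the constant $1$, put $P^D=\mathrm{span}\{1,\ \langle g,\nu\rangle^k : k\ge1,\ g\in D\}$ and $D^{\otimes k}=\mathrm{span}\{g^{\otimes k}: g\in D\}$, and let $\partial_xp(\nu)$ be the derivative of $p$ at $\nu$ in direction $\delta_x$, with $\partial p(\nu)$ and $\partial^2p(\nu)$ the functions $x\mapsto\partial_xp(\nu)$ and $(x,y)\mapsto\partial_x\partial_yp(\nu)$. Let $L\colon P^D\to P$ be a linear operator for which there are linear operators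 $B\colon D\to C_\Delta(E)$ and $Q\colon D\otimes D\to\widehat C_\Delta(E^2)$ such that for all $p\in P^D$ $$Lp(\nu)=\langle B(\partial p(\nu)),\nu\rangle+\tfrac12\langle Q(\partial^2p(\nu)),\nu^2\rangle,\qquad \nu\in M_1(E).$$ For $k\ge1$ let $L_k\colon D^{\otimes k}\to\widehat C_\Delta(E^k)$ be the $k$-th dual operator, the unique linear operator with $Lp(\nu)=\langle L_kg,\nu^k\rangle$ on $M_1(E)$ whenever $p(\nu)=\langle g,\nu^k\rangle$, $g\in D^{\otimes k}$. A solution to the martingale problem for $L$ with initial condition $\nu\in M_1(E)$ is an adapted càdlàg $M_1(E)$-valued process $X$ on a filtered probability space such that $X_0=\nu$ almost surely and $p(X_t)-p(X_0)-\int_0^tLp(X_s)\,ds$ is a martingale for every $p\in P^D$. Let $X$ be a solution with continuous paths and initial condition $\nu$. Suppose that the moment formula holds for all $k\ge1$ and $g\in D^{\otimes k}$, that is: each $L_k$ is closable with closure $\overline L_k$, and for every $g\in D^{\otimes k}$ there is a given solution $u_g\colon\mathbb R_+\times E^k\to\mathbb R$, with $u_g(t,\cdot)$ in the domain of $\overline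 L_k$ for all $t\ge 0$, of $$\partial_tu_g(t,x)=\overline L_ku_g(t,\cdot)(x),\qquad u_g(0,x)=g(x),\qquad (t,x)\in\mathbb R_+\times E^k,$$ such that $$\mathbb E[\langle g,X_T^k\rangle\mid\mathcal F_t]=\langle u_g(T-t,\cdot),X_t^k\rangle\quad\text{a.s., for all } 0\le t\le T.$$ Then the law of $X$ is uniquely determined by $L$ and $\nu$, in the following sense. (i) Every solution $X'$ to the martingale problem for $L$ with initial condition $\nu$, on any filtered probability space, for which the moment formula holds with the same functions $u_g$, for all $k\ge1$ and $g\in D^{\otimes k}$, has the same law as $X$. (ii) If moreover $\sup_{t\in[0,T]}\|\overline L_ku_g(t,\cdot)\|<\infty$ for all $T\ge0$, $k\ge1$ and $g\in D^{\otimes k}$, then every solution $X'$ to the martingale problem for $L$ with initial condition $\nu$, on any filtered probability space, has the same law as $X$. -/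

import Mathlib

open MeasureTheory Filter Topology Set
open scoped NNReal BoundedContinuousFunction

noncomputable section

namespace PolyDiff

section FunctionSpaces

variable (E : Type*) [TopologicalSpace E]

/-- `C_Δ(E)`: the restrictions to `E` of the continuous functions on the one-point
compactification. If `E` is compact, the added point is isolated in `OnePoint E`, and `C_Δ(E)` is
all of `C(E)`, so that no case distinction is needed. -/
def CDelta : Submodule ℝ (E →ᵇ ℝ) where
  carrier := {f | ∃ F : C(OnePoint E, ℝ), ∀ x : E, f x = F x}
  zero_mem' := ⟨0, fun _ => rfl⟩
  add_mem' := by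
    rintro f g ⟨F, hF⟩ ⟨G, hG⟩
    exact ⟨F + G, fun x => by simp [hF x, hG x]⟩
  smul_mem' := by
    rintro c f ⟨F, hF⟩
    exact ⟨c • F, fun x => by simp [hF x]⟩

/-- `Ĉ_Δ(E^k)`: the symmetric functions on `E^k` that are restrictions of continuous functions on
the `k`-fold product of the one-point compactification. -/
def SymCDelta (k : ℕ) : Submodule ℝ ((Fin k → E) →ᵇ ℝ) where
  carrier := {f | (∃ F : C(Fin k → OnePoint E, ℝ),
      ∀ x : Fin k → E, f x = F (fun i => (x i : OnePoint E))) ∧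
    ∀ (σ : Equiv.Perm (Fin k)) (x : Fin k → E), f (x ∘ σ) = f x}
  zero_mem' := ⟨⟨0, fun _ => rfl⟩, fun _ _ => rfl⟩
  add_mem' := by
    rintro f g ⟨⟨F, hF⟩, hf⟩ ⟨⟨G, hG⟩, hg⟩
    exact ⟨⟨F + G, fun x => by simp [hF x, hG x]⟩, fun σ x => by simp [hf σ x, hg σ x]⟩
  smul_mem' := by
    rintro c f ⟨⟨F, hF⟩, hf⟩
    exact ⟨⟨c • F, fun x => by simp [hF x]⟩, fun σ x => by simp [hf σ x]⟩

variable {E}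

/-- `D^{⊗k}`: the linear span of the functions `(x₁, …, x_k) ↦ g(x₁) ⋯ g(x_k)` with `g ∈ D`. -/
def tensorPow (D : Submodule ℝ (E →ᵇ ℝ)) (k : ℕ) : Submodule ℝ ((Fin k → E) →ᵇ ℝ) :=
  Submodule.span ℝ {f | ∃ g ∈ D, ∀ x : Fin k → E, f x = ∏ i, g (x i)}

end FunctionSpaces

section Polynomials

variable {E : Type*} [TopologicalSpace E] [MeasurableSpace E]

/-- `⟨g, ν⟩` for a signed measure `ν`. -/
def linPairing (g : E →ᵇ ℝ) (ν : SignedMeasure E) : ℝ :=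
  (∫ x, g x ∂ν.toJordanDecomposition.posPart) - ∫ x, g x ∂ν.toJordanDecomposition.negPart

/-- `⟨g, ν^k⟩` for a signed measure `ν = ν₊ - ν₋`: the integral of `g` against the `k`-fold product
measure `ν ⊗ ⋯ ⊗ ν`, expanded multilinearly into products of copies of `ν₊` and `ν₋`. -/
def monomial {k : ℕ} (g : (Fin k → E) →ᵇ ℝ) (ν : SignedMeasure E) : ℝ :=
  ∑ s : Finset (Fin k), (-1 : ℝ) ^ (sᶜ).card *
    ∫ x, g x ∂(Measure.pi fun i => if i ∈ s then ν.toJordanDecomposition.posPart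
      else ν.toJordanDecomposition.negPart)

/-- `⟨g, μ^k⟩` for a probability measure `μ`. -/
def pairing {k : ℕ} (g : (Fin k → E) →ᵇ ℝ) (μ : ProbabilityMeasure E) : ℝ :=
  ∫ x, g x ∂(Measure.pi fun _ => (μ : Measure E))

/-- The inclusion of `M_1(E)` in the space `M(E)` of signed measures. -/
def toM (μ : ProbabilityMeasure E) : SignedMeasure E :=
  (μ : Measure E).toSignedMeasure

variable (E) in
/-- The space `P` of polynomials on `M(E)`, as functions on `M(E)`. -/
def MPoly : Submodule ℝ (SignedMeasure E → ℝ) :=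
  Submodule.span ℝ {p | ∃ (k : ℕ) (g : (Fin k → E) →ᵇ ℝ), g ∈ SymCDelta E k ∧ p = monomial g}

/-- `P^D`, the linear span of the constant `1` and the functions `ν ↦ ⟨g, ν⟩^k`, `k ≥ 1`,
`g ∈ D`. -/
def PolyD (D : Submodule ℝ (E →ᵇ ℝ)) : Submodule ℝ (SignedMeasure E → ℝ) :=
  Submodule.span ℝ ({fun _ => 1} ∪
    {p | ∃ k : ℕ, 1 ≤ k ∧ ∃ g ∈ D, p = fun ν => linPairing g ν ^ k})

/-- `∂_x f(ν)`, the derivative of `f` at `ν` in direction `δ_x`. -/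
def diracDeriv (x : E) (f : SignedMeasure E → ℝ) (ν : SignedMeasure E) : ℝ :=
  lineDeriv ℝ f ν (Measure.dirac x).toSignedMeasure

/-- `L` is of the form `Lp(μ) = ⟨B(∂p(μ)), μ⟩ + ½ ⟨Q(∂²p(μ)), μ²⟩`, `μ ∈ M_1(E)`, for some linear
operators `B : D → C_Δ(E)` and `Q : D ⊗ D → Ĉ_Δ(E²)`. -/
def HasPolynomialForm (D : Submodule ℝ (E →ᵇ ℝ)) (L : PolyD D →ₗ[ℝ] MPoly E) : Prop :=
  ∃ (B : D →ₗ[ℝ] CDelta E) (Q : tensorPow D 2 →ₗ[ℝ] SymCDelta E 2),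
    ∀ (p : PolyD D) (μ : ProbabilityMeasure E),
      ∃ (d : D) (e : tensorPow D 2),
        (∀ x, (d : E →ᵇ ℝ) x = diracDeriv x p (toM μ)) ∧
        (∀ x : Fin 2 → E, (e : (Fin 2 → E) →ᵇ ℝ) x =
          diracDeriv (x 0) (diracDeriv (x 1) p) (toM μ)) ∧
        (L p : SignedMeasure E → ℝ) (toM μ) =
          ∫ x, (B d : E →ᵇ ℝ) x ∂(μ : Measure E) + (1 / 2) * pairing (Q e : (Fin 2 → E) →ᵇ ℝ) μ

variable [OpensMeasurableSpace E] [SecondCountableTopology E]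

set_option linter.unusedSectionVars false

lemma integrable_pi {k : ℕ} (g : (Fin k → E) →ᵇ ℝ) (m : Fin k → Measure E)
    [∀ i, IsFiniteMeasure (m i)] : Integrable (fun x => g x) (Measure.pi m) :=
  g.integrable _

instance {k : ℕ} (ν : SignedMeasure E) (s : Finset (Fin k)) (i : Fin k) :
    IsFiniteMeasure (if i ∈ s then ν.toJordanDecomposition.posPart
      else ν.toJordanDecomposition.negPart) := by
  split_ifs <;> infer_instance

lemma pairing_add {k : ℕ} (g h : (Fin k → E) →ᵇ ℝ) (μ : ProbabilityMeasure E) :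
    pairing (g + h) μ = pairing g μ + pairing h μ :=
  integral_add (integrable_pi g _) (integrable_pi h _)

lemma pairing_smul {k : ℕ} (c : ℝ) (g : (Fin k → E) →ᵇ ℝ) (μ : ProbabilityMeasure E) :
    pairing (c • g) μ = c * pairing g μ :=
  integral_const_mul c _

lemma monomial_add {k : ℕ} (g h : (Fin k → E) →ᵇ ℝ) (ν : SignedMeasure E) :
    monomial (g + h) ν = monomial g ν + monomial h ν := by
  simp only [monomial, ← Finset.sum_add_distrib, ← mul_add]
  refine Finset.sum_congr rfl fun s _ => ?_
  congr 1
  exact integral_add (integrable_pi g _) (integrable_pi h _)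

lemma monomial_smul {k : ℕ} (c : ℝ) (g : (Fin k → E) →ᵇ ℝ) (ν : SignedMeasure E) :
    monomial (c • g) ν = c * monomial g ν := by
  simp only [monomial, Finset.mul_sum]
  refine Finset.sum_congr rfl fun s _ => ?_
  rw [mul_left_comm]
  congr 1
  exact integral_const_mul c _

/-- The graph of the `k`-th dual operator of `L`: the pairs `(g, h)` with `g ∈ D^{⊗k}`,
`h ∈ Ĉ_Δ(E^k)` and `Lp(μ) = ⟨h, μ^k⟩` for all `μ ∈ M_1(E)`, where `p(ν) = ⟨g, ν^k⟩`. -/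
def dualGraph (D : Submodule ℝ (E →ᵇ ℝ)) (L : PolyD D →ₗ[ℝ] MPoly E) (k : ℕ) :
    Submodule ℝ (((Fin k → E) →ᵇ ℝ) × ((Fin k → E) →ᵇ ℝ)) where
  carrier := {gh | gh.1 ∈ tensorPow D k ∧ gh.2 ∈ SymCDelta E k ∧
    ∃ p : PolyD D, (p : SignedMeasure E → ℝ) = monomial gh.1 ∧
      ∀ μ : ProbabilityMeasure E, (L p : SignedMeasure E → ℝ) (toM μ) = pairing gh.2 μ}
  zero_mem' := by
    refine ⟨zero_mem _, zero_mem _, 0, ?_, fun μ => ?_⟩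
    · ext ν
      simp [monomial]
    · simp [pairing]
  add_mem' := by
    rintro ⟨g, h⟩ ⟨g', h'⟩ ⟨hg, hh, p, hp, hL⟩ ⟨hg', hh', p', hp', hL'⟩
    refine ⟨add_mem hg hg', add_mem hh hh', p + p', ?_, fun μ => ?_⟩
    · ext ν
      simp only [Submodule.coe_add, Pi.add_apply, hp, hp', Prod.mk_add_mk, monomial_add]
    · simp only [map_add, Submodule.coe_add, Pi.add_apply, hL, hL', Prod.mk_add_mk, pairing_add]
  smul_mem' := by
    rintro c ⟨g, h⟩ ⟨hg, hh, p, hp, hL⟩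
    refine ⟨Submodule.smul_mem _ c hg, Submodule.smul_mem _ c hh, c • p, ?_, fun μ => ?_⟩
    · ext ν
      simp only [Submodule.coe_smul, Pi.smul_apply, hp, Prod.smul_mk, monomial_smul, smul_eq_mul]
    · simp only [map_smul, Submodule.coe_smul, Pi.smul_apply, hL, Prod.smul_mk, pairing_smul,
        smul_eq_mul]

/-- The `k`-th dual operator `L_k` of `L`, as a partially defined operator between spaces of bounded
continuous functions on `E^k`. Its values lie in `Ĉ_Δ(E^k)`, which is closed. If `L` has the
polynomial form, then its domain is `D^{⊗k}`, and `Lp(μ) = ⟨L_k g, μ^k⟩` on `M_1(E)` determines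
`L_k g` uniquely. -/
def dualOp (D : Submodule ℝ (E →ᵇ ℝ)) (L : PolyD D →ₗ[ℝ] MPoly E) (k : ℕ) :
    ((Fin k → E) →ᵇ ℝ) →ₗ.[ℝ] ((Fin k → E) →ᵇ ℝ) :=
  (dualGraph D L k).toLinearPMap

end Polynomials

section Evolution

variable {Y : Type*} [TopologicalSpace Y]

/-- `u : ℝ₊ × Y → ℝ` solves `∂u/∂t (t, x) = (A u(t, ·))(x)` on `ℝ₊ × Y` with `u(0, ·) = g`. In
particular `u(t, ·)` lies in the domain of `A`. The derivative at `t = 0` is the right one. -/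
structure SolvesPIDE (A : (Y →ᵇ ℝ) →ₗ.[ℝ] (Y →ᵇ ℝ)) (g : Y →ᵇ ℝ) (u : ℝ≥0 → (Y →ᵇ ℝ)) :
    Prop where
  mem_domain : ∀ t, u t ∈ A.domain
  initial : u 0 = g
  deriv_eq : ∀ (t : ℝ≥0) (x : Y),
    HasDerivWithinAt (fun s : ℝ => u s.toNNReal x) (A ⟨u t, mem_domain t⟩ x) (Ici 0) (t : ℝ)

/-- `sup_{t ∈ [0,T]} ‖A u(t, ·)‖ < ∞` for all `T`. -/
def LocallyBoundedImage (A : (Y →ᵇ ℝ) →ₗ.[ℝ] (Y →ᵇ ℝ)) (u : ℝ≥0 → (Y →ᵇ ℝ)) : Prop :=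
  ∀ T : ℝ≥0, ∃ C : ℝ, ∀ t ≤ T, ∀ h : u t ∈ A.domain, ‖A ⟨u t, h⟩‖ ≤ C

end Evolution

section Processes

variable {E : Type*} [TopologicalSpace E] [MeasurableSpace E] [OpensMeasurableSpace E]
variable {Ω : Type*} {mΩ : MeasurableSpace Ω}

/-- `X` is an adapted `M_1(E)`-valued process with càdlàg paths (for weak convergence) that solves
the martingale problem for `L` with initial condition `ν`. -/
structure IsSolution (D : Submodule ℝ (E →ᵇ ℝ)) (L : PolyD D →ₗ[ℝ] MPoly E)
    (ν : ProbabilityMeasure E) (ℱ : Filtration ℝ≥0 mΩ) (ℙ : Measure Ω)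
    (X : ℝ≥0 → Ω → ProbabilityMeasure E) : Prop where
  adapted : ∀ t, Measurable[ℱ t] (X t)
  right_continuous : ∀ ω t, ContinuousWithinAt (fun s => X s ω) (Ici t) t
  left_limits : ∀ ω t, ∃ l, Tendsto (fun s => X s ω) (𝓝[<] t) (𝓝 l)
  initial : ∀ᵐ ω ∂ℙ, X 0 ω = ν
  martingale : ∀ p : PolyD D, Martingale (fun (t : ℝ≥0) ω =>
    (p : SignedMeasure E → ℝ) (toM (X t ω)) - (p : SignedMeasure E → ℝ) (toM (X 0 ω)) -
      ∫ s in (0 : ℝ)..t, (L p : SignedMeasure E → ℝ) (toM (X s.toNNReal ω))) ℱ ℙ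

/-- The moment formula `𝔼[⟨g, X_T^k⟩ | ℱ_t] = ⟨u(T - t, ·), X_t^k⟩` almost surely, for all
`0 ≤ t ≤ T`. -/
def MomentFormula {k : ℕ} (ℱ : Filtration ℝ≥0 mΩ) (ℙ : Measure Ω)
    (X : ℝ≥0 → Ω → ProbabilityMeasure E) (g : (Fin k → E) →ᵇ ℝ)
    (u : ℝ≥0 → ((Fin k → E) →ᵇ ℝ)) : Prop :=
  ∀ t T : ℝ≥0, t ≤ T →
    ℙ[fun ω => pairing g (X T ω) | ℱ t] =ᵐ[ℙ] fun ω => pairing (u (T - t)) (X t ω)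

/-- The law of a process, on the path space with the σ-algebra generated by the coordinates. -/
def processLaw (ℙ : Measure Ω) (X : ℝ≥0 → Ω → ProbabilityMeasure E) :
    Measure (ℝ≥0 → ProbabilityMeasure E) :=
  ℙ.map fun ω t => X t ω

end Processes

end PolyDiff

end

open PolyDiff

/-! The moment formula acts as a Markov property on polynomials. The functions `⟨g, ·⟩`, `g ∈ D`,
generate an algebra on `M_1(E)` which, by polarization and because `1 ∈ D`, is already spanned by
their powers `⟨g, ·⟩ ^ k`. For such a power the conditional expectation of `p(X_{t+s})` given `ℱ_t`
is `q(X_t)`, where `q` is read off from `u` and hence is the same for every process satisfying the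
formula. Since `u(s, ·)` lies in the domain of the closed dual operator, it is a uniform limit of
elements of `D^{⊗k}`, so `q` lies in the uniform closure of the algebra
(`predicts_of_momentFormula`). That closure is stable under products, so conditioning can be
iterated from the last time back to the deterministic start (`integral_prod_mul_eq`). By Weierstrass
approximation this fixes the joint laws of all `⟨g, X_t⟩`, and by density of `D` these generate the
path σ-algebra (`processLaw_eq_of_integral_prod_eq`).

Under the bound in (ii) every solution satisfies the moment formula (`IsSolution.momentFormula`).
For `A ∈ ℱ_t` put `f(s, r) = 𝔼[1_A ⟨u(s), X_{t+r}^k⟩]`. The evolution equation gives its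
`s`-derivative, the martingale problem (extended to the closed operator) its `r`-derivative in
integrated form, and the two agree. Thus `f` is constant along `s + r = T - t`
(`eq_of_deriv_eq_of_integral_eq`). -/

namespace PolyDiff

set_option linter.unusedSectionVars false

/-! ### Pairings with powers of a probability measure -/

section Basics

variable {E : Type*} [TopologicalSpace E] [MeasurableSpace E]

lemma toJordanDecomposition_toM (μ : ProbabilityMeasure E) :
    (toM μ).toJordanDecomposition =
      { posPart := (μ : Measure E)
        negPart := 0
        mutuallySingular := Measure.MutuallySingular.zero_right } := by
  apply SignedMeasure.toJordanDecomposition_eq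
  simp [toM, JordanDecomposition.toSignedMeasure]

lemma monomial_toM {k : ℕ} (g : (Fin k → E) →ᵇ ℝ) (μ : ProbabilityMeasure E) :
    monomial g (toM μ) = pairing g μ := by
  unfold monomial pairing
  simp only [toJordanDecomposition_toM]
  -- The negative part is zero, so any term containing a copy of it vanishes.
  rw [Finset.sum_eq_single Finset.univ]
  · simp
  · intro s _ hs
    obtain ⟨i, hi⟩ : ∃ i, i ∉ s := by
      by_contra! h
      exact hs (Finset.eq_univ_iff_forall.2 h)
    have : (Measure.pi fun i => if i ∈ s then (μ : Measure E) else 0) = 0 := by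
      have hfin : ∀ i, IsFiniteMeasure (if i ∈ s then (μ : Measure E) else 0) := fun i => by
        split_ifs <;> infer_instance
      rw [← Measure.measure_univ_eq_zero, Measure.pi_univ]
      exact Finset.prod_eq_zero (Finset.mem_univ i) (by simp [hi])
    rw [this]
    simp
  · simp

lemma measurable_pi_probabilityMeasure (k : ℕ) :
    Measurable fun μ : ProbabilityMeasure E => Measure.pi fun _ : Fin k => (μ : Measure E) := by
  refine Measurable.measure_of_isPiSystem_of_isProbabilityMeasure generateFrom_pi.symm
    isPiSystem_pi ?_
  rintro _ ⟨s, hs, rfl⟩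
  simp only [Measure.pi_pi]
  refine Finset.measurable_fun_prod _ fun i _ => ?_
  exact (Measure.measurable_coe (hs i (mem_univ i))).comp measurable_subtype_coe

variable [OpensMeasurableSpace E] [SecondCountableTopology E]

lemma measurable_pairing {k : ℕ} (g : (Fin k → E) →ᵇ ℝ) :
    Measurable (pairing g : ProbabilityMeasure E → ℝ) := by
  let κ : ProbabilityTheory.Kernel (ProbabilityMeasure E) (Fin k → E) :=
    ⟨_, measurable_pi_probabilityMeasure k⟩
  have : ProbabilityTheory.IsMarkovKernel κ :=
    ⟨fun μ => inferInstanceAs (IsProbabilityMeasure (Measure.pi fun _ => (μ : Measure E)))⟩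
  exact (MeasureTheory.StronglyMeasurable.integral_kernel (κ := κ)
    g.continuous.measurable.stronglyMeasurable).measurable

lemma abs_pairing_le {k : ℕ} (g : (Fin k → E) →ᵇ ℝ) (μ : ProbabilityMeasure E) :
    |pairing g μ| ≤ ‖g‖ := by
  have := g.norm_integral_le_norm (Measure.pi fun _ : Fin k => (μ : Measure E))
  simpa [pairing] using this

lemma pairing_sub {k : ℕ} (g h : (Fin k → E) →ᵇ ℝ) (μ : ProbabilityMeasure E) :
    pairing (g - h) μ = pairing g μ - pairing h μ :=
  integral_sub (integrable_pi g _) (integrable_pi h _)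

lemma abs_pairing_sub_le {k : ℕ} (g h : (Fin k → E) →ᵇ ℝ) (μ : ProbabilityMeasure E) :
    |pairing g μ - pairing h μ| ≤ ‖g - h‖ := by
  rw [← pairing_sub]
  exact abs_pairing_le _ _

lemma continuous_pairing [TopologicalSpace.PseudoMetrizableSpace E] {k : ℕ}
    (g : (Fin k → E) →ᵇ ℝ) : Continuous (pairing g : ProbabilityMeasure E → ℝ) := by
  have h1 : Continuous fun μ : ProbabilityMeasure E =>
      ProbabilityMeasure.pi fun _ : Fin k => μ :=
    ProbabilityMeasure.continuous_pi.comp (continuous_pi fun _ => continuous_id)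
  exact (ProbabilityMeasure.continuous_integral_boundedContinuousFunction g).comp h1

end Basics

/-! ### The dual operators are single-valued -/

section Functionality

variable {E : Type*} [TopologicalSpace E] [MeasurableSpace E]

lemma bijective_of_sum_single_eq {k : ℕ} (f : Fin k → Fin k)
    (h : ∑ j, Finsupp.single (f j) 1 = ∑ j : Fin k, (Finsupp.single j 1 : Fin k →₀ ℕ)) :
    Function.Bijective f := by
  rw [← Finite.surjective_iff_bijective]
  intro i
  have := DFunLike.congr_fun h i
  simp only [Finsupp.coe_finsetSum, Finset.sum_apply, Finsupp.single_apply] at this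
  by_contra! hi
  simp [hi] at this

/-- Read the sum as a polynomial in the weights: only bijective `f` contribute to the multilinear
monomial `w₁ ⋯ w_k`, whose coefficient is therefore `a` times the number of permutations. A
polynomial vanishing on the positive orthant has all coefficients zero. -/
lemma eq_zero_of_sum_prod_mul_eq_zero {k : ℕ} (c : (Fin k → Fin k) → ℝ) (a : ℝ)
    (hc : ∀ f, Function.Bijective f → c f = a)
    (h : ∀ w : Fin k → ℝ, (∀ i, w i ∈ Ioi (0 : ℝ)) → ∑ f, (∏ j, w (f j)) * c f = 0) : a = 0 := by
  classical
  let P : MvPolynomial (Fin k) ℝ :=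
    ∑ f : Fin k → Fin k, MvPolynomial.monomial (∑ j, Finsupp.single (f j) 1) (c f)
  have hP : P = 0 := by
    refine MvPolynomial.funext_set (fun _ => Ioi (0 : ℝ)) (fun _ => Ioi_infinite 0) fun w hw => ?_
    have := h w fun i => hw i (mem_univ i)
    rw [map_zero, ← this]
    simp only [P, map_sum, MvPolynomial.eval_monomial]
    refine Finset.sum_congr rfl fun f _ => ?_
    rw [mul_comm]
    congr 1
    rw [← Finsupp.prod_finsetSum_index (by simp) (by intros; rw [pow_add])]
    simp [Finsupp.prod_single_index]
  have hcoef : MvPolynomial.coeff (∑ j : Fin k, Finsupp.single j 1) P = 0 := by rw [hP]; simp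
  simp only [P, MvPolynomial.coeff_sum, MvPolynomial.coeff_monomial] at hcoef
  rw [Finset.sum_congr rfl (g := fun f : Fin k → Fin k =>
    if ∑ j, Finsupp.single (f j) 1 = ∑ j : Fin k, (Finsupp.single j 1 : Fin k →₀ ℕ)
      then a else 0)] at hcoef
  · rw [← Finset.sum_filter, Finset.sum_const, nsmul_eq_mul, mul_eq_zero] at hcoef
    refine hcoef.resolve_left ?_
    rw [Nat.cast_eq_zero, Finset.card_eq_zero]
    exact Finset.ne_empty_of_mem (a := id) (by simp)
  · intro f _
    split_ifs with hf
    · exact hc f (bijective_of_sum_single_eq f hf)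
    · rfl

variable [OpensMeasurableSpace E] [SecondCountableTopology E]

lemma pairing_map_eq_sum {k : ℕ} (h : (Fin k → E) →ᵇ ℝ) (x : Fin k → E)
    (m : ProbabilityMeasure (Fin k)) :
    pairing h (m.map (f := x) (measurable_of_finite x).aemeasurable) =
      ∑ f : Fin k → Fin k, (∏ j, (m : Measure (Fin k)).real {f j}) * h (x ∘ f) := by
  unfold pairing
  rw [ProbabilityMeasure.toMeasure_map,
    ← Measure.pi_map_pi (fun _ => (measurable_of_finite x).aemeasurable), integral_map]
  · rw [integral_fintype (Integrable.of_finite)]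
    refine Finset.sum_congr rfl fun f _ => ?_
    simp only [smul_eq_mul, measureReal_def, Measure.pi_singleton, ENNReal.toReal_prod]
    rfl
  · exact (measurable_of_finite _).aemeasurable
  · exact h.continuous.measurable.aestronglyMeasurable

/-- Test against the atomic measures with masses proportional to `w i` at `x i`: the pairing is a
homogeneous polynomial in `w`, and by symmetry every permutation contributes the value `h x` to its
multilinear coefficient. -/
lemma eq_zero_of_pairing_eq_zero {k : ℕ} (h : (Fin k → E) →ᵇ ℝ)
    (hsymm : ∀ (σ : Equiv.Perm (Fin k)) (x : Fin k → E), h (x ∘ σ) = h x)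
    (h0 : ∀ μ : ProbabilityMeasure E, pairing h μ = 0) (hE : Nonempty E) : h = 0 := by
  ext x
  -- For `k = 0` the space `E^0` is a point even if `E` is empty, so some probability measure has to
  -- be exhibited.
  rcases Nat.eq_zero_or_pos k with rfl | hk
  · obtain ⟨e⟩ := hE
    have hconst : ∀ y, h y = h x := fun y => congrArg h (Subsingleton.elim _ _)
    simpa [pairing, hconst] using h0 ⟨Measure.dirac e, inferInstance⟩
  refine eq_zero_of_sum_prod_mul_eq_zero (fun f => h (x ∘ f)) (h x)
    (fun f hf => hsymm (Equiv.ofBijective f hf) x) fun w hw => ?_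
  have : Nonempty (Fin k) := ⟨⟨0, hk⟩⟩
  set S := ∑ i, w i with hS
  have hSpos : 0 < S := Finset.sum_pos (fun i _ => hw i) Finset.univ_nonempty
  let m : Measure (Fin k) := ∑ i, ENNReal.ofReal (w i / S) • Measure.dirac i
  have hm : ∀ i, m {i} = ENNReal.ofReal (w i / S) := fun i => by
    simp only [m, Measure.coe_finsetSum, Finset.sum_apply, Measure.smul_apply,
      Measure.dirac_apply' _ (measurableSet_singleton _), smul_eq_mul]
    rw [Finset.sum_eq_single i] <;> simp +contextual [Set.indicator]
  have hprob : IsProbabilityMeasure m := ⟨by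
    simp only [m, Measure.coe_finsetSum, Finset.sum_apply, Measure.smul_apply, measure_univ,
      smul_eq_mul, mul_one]
    rw [← ENNReal.ofReal_sum_of_nonneg (fun i _ => (div_pos (hw i) hSpos).le), ← Finset.sum_div,
      ← hS, div_self hSpos.ne', ENNReal.ofReal_one]⟩
  have := (pairing_map_eq_sum h x ⟨m, hprob⟩).symm.trans (h0 _)
  have hreal : ∀ i, m.real {i} = w i / S := fun i => by
    rw [measureReal_def, hm, ENNReal.toReal_ofReal (div_pos (hw i) hSpos).le]
  simp only [ProbabilityMeasure.coe_mk, hreal, Finset.prod_div_distrib, Finset.prod_const,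
    Finset.card_univ, Fintype.card_fin] at this
  simp only [div_mul_eq_mul_div, ← Finset.sum_div] at this
  exact (div_eq_zero_iff.1 this).resolve_right (pow_pos hSpos k).ne'

lemma dualGraph_snd_eq_zero (D : Submodule ℝ (E →ᵇ ℝ)) (L : PolyD D →ₗ[ℝ] MPoly E) (k : ℕ)
    (hE : Nonempty E) (x : ((Fin k → E) →ᵇ ℝ) × ((Fin k → E) →ᵇ ℝ)) (hx : x ∈ dualGraph D L k)
    (hx1 : x.1 = 0) : x.2 = 0 := by
  obtain ⟨-, ⟨-, hsymm⟩, p, hp, hL⟩ := hx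
  refine eq_zero_of_pairing_eq_zero _ hsymm (fun μ => ?_) hE
  have hp0 : p = 0 := by
    apply Subtype.ext
    rw [hp, hx1]
    ext ν
    simp [monomial]
  rw [← hL, hp0]
  simp

/-- `toLinearPMap` keeps the given graph only when that graph is single-valued, which is what the
vanishing result for symmetric functions supplies. -/
lemma dualOp_graph (D : Submodule ℝ (E →ᵇ ℝ)) (L : PolyD D →ₗ[ℝ] MPoly E) (k : ℕ)
    (hE : Nonempty E) : (dualOp D L k).graph = dualGraph D L k :=
  Submodule.toLinearPMap_graph_eq _ (dualGraph_snd_eq_zero D L k hE)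

lemma mem_closure_dualGraph (D : Submodule ℝ (E →ᵇ ℝ)) (L : PolyD D →ₗ[ℝ] MPoly E) (k : ℕ)
    (hE : Nonempty E) (hcl : (dualOp D L k).IsClosable) (v : (dualOp D L k).closure.domain) :
    ((v : (Fin k → E) →ᵇ ℝ), (dualOp D L k).closure v) ∈
      closure (dualGraph D L k : Set (((Fin k → E) →ᵇ ℝ) × ((Fin k → E) →ᵇ ℝ))) := by
  rw [← dualOp_graph D L k hE, ← Submodule.topologicalClosure_coe,
    hcl.graph_closure_eq_closure_graph]
  exact (dualOp D L k).closure.mem_graph v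

end Functionality

/-! ### Functions with equal partial derivatives in two time variables -/

section Characteristics

/-- Dominated convergence for the difference quotients, which the local Lipschitz bound dominates by
the constant `C`. -/
lemma hasDerivWithinAt_integral_of_lipschitz {Y : Type*} [MeasurableSpace Y] (m : Measure Y)
    [IsFiniteMeasure m] (v : ℝ → Y → ℝ) (v' : Y → ℝ) (s C δ : ℝ) (hδ : 0 < δ)
    (hint : ∀ x, Integrable (v x) m)
    (hlip : ∀ x ∈ Ici (0 : ℝ), |x - s| < δ → ∀ y, |v x y - v s y| ≤ C * |x - s|)
    (hderiv : ∀ y, HasDerivWithinAt (fun x => v x y) (v' y) (Ici 0) s) :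
    HasDerivWithinAt (fun x => ∫ y, v x y ∂m) (∫ y, v' y ∂m) (Ici 0) s := by
  rw [hasDerivWithinAt_iff_tendsto_slope]
  have hslope : ∀ x, slope (fun x => ∫ y, v x y ∂m) s x = ∫ y, slope (fun x => v x y) s x ∂m := by
    intro x
    simp only [slope_def_module, smul_eq_mul]
    rw [integral_const_mul, integral_sub (hint x) (hint s)]
  simp only [funext hslope]
  refine tendsto_integral_filter_of_dominated_convergence (fun _ => C) ?_ ?_
    (integrable_const C) ?_
  · refine Eventually.of_forall fun x => ?_
    simp only [slope_def_module, smul_eq_mul]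
    exact (((hint x).sub (hint s)).const_mul _).aestronglyMeasurable
  · have hnear : ∀ᶠ x in 𝓝[Ici 0 \ {s}] s, |x - s| < δ := by
      refine mem_nhdsWithin_of_mem_nhds ?_
      filter_upwards [Metric.ball_mem_nhds s hδ] with x hx
      simpa [Real.dist_eq] using hx
    filter_upwards [self_mem_nhdsWithin, hnear] with x hx hxδ
    refine Eventually.of_forall fun y => ?_
    have hpos : 0 < |x - s| := abs_pos.2 (sub_ne_zero.2 hx.2)
    rw [slope_def_field, norm_div, Real.norm_eq_abs, Real.norm_eq_abs, div_le_iff₀ hpos]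
    exact hlip x hx.1 hxδ y
  · exact Eventually.of_forall fun y => hasDerivWithinAt_iff_tendsto_slope.1 (hderiv y)

/-- Two iterated integrals over the triangle `{σ, ρ ≥ 0, σ + ρ ≤ a}` agree. -/
lemma integral_triangle_swap (ψ : ℝ → ℝ → ℝ) (hψ : Measurable (Function.uncurry ψ)) (a C : ℝ)
    (ha : 0 ≤ a) (hC : ∀ σ ∈ Ioc 0 a, ∀ ρ ∈ Ioc 0 a, |ψ σ ρ| ≤ C) :
    ∫ σ in (0 : ℝ)..a, ∫ ρ in (0 : ℝ)..a - σ, ψ σ ρ =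
      ∫ ρ in (0 : ℝ)..a, ∫ σ in (0 : ℝ)..a - ρ, ψ σ ρ := by
  -- Extending by zero turns both iterated integrals into integrals over one square, where Fubini
  -- applies.
  let Ψ : ℝ → ℝ → ℝ := fun σ ρ => if σ + ρ ≤ a then ψ σ ρ else 0
  have e1 : ∀ σ ∈ uIcc 0 a, ∫ ρ in (0 : ℝ)..a - σ, ψ σ ρ = ∫ ρ in (0 : ℝ)..a, Ψ σ ρ := by
    intro σ hσ
    rw [uIcc_of_le ha] at hσ
    rw [← intervalIntegral.integral_indicator (a₁ := 0) (a₂ := a - σ) (a₃ := a)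
      ⟨by linarith [hσ.2], by linarith [hσ.1]⟩]
    congr 1
    ext ρ
    simp only [Ψ, indicator, mem_ofPred_eq, le_sub_iff_add_le, add_comm]
  have e2 : ∀ ρ ∈ uIcc 0 a, ∫ σ in (0 : ℝ)..a - ρ, ψ σ ρ = ∫ σ in (0 : ℝ)..a, Ψ σ ρ := by
    intro ρ hρ
    rw [uIcc_of_le ha] at hρ
    rw [← intervalIntegral.integral_indicator (a₁ := 0) (a₂ := a - ρ) (a₃ := a)
      ⟨by linarith [hρ.2], by linarith [hρ.1]⟩]
    congr 1
    ext σ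
    simp only [Ψ, indicator, mem_ofPred_eq, le_sub_iff_add_le]
  rw [intervalIntegral.integral_congr e1, intervalIntegral.integral_congr e2]
  refine intervalIntegral_intervalIntegral_swap ?_
  have hmeas : Measurable (Function.uncurry Ψ) :=
    Measurable.ite (measurableSet_le (measurable_fst.add measurable_snd) measurable_const) hψ
      measurable_const
  rw [uIoc_of_le ha]
  have hfin : IsFiniteMeasure ((volume : Measure (ℝ × ℝ)).restrict (Ioc 0 a ×ˢ Ioc 0 a)) := by
    rw [Measure.volume_eq_prod, ← Measure.prod_restrict]
    infer_instance
  refine Integrable.of_bound hmeas.aestronglyMeasurable |C| ?_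
  refine (ae_restrict_iff' (measurableSet_Ioc.prod measurableSet_Ioc)).2
    (Eventually.of_forall fun z hz => ?_)
  simp only [Function.uncurry, Ψ]
  split_ifs
  · exact (hC _ hz.1 _ hz.2).trans (le_abs_self C)
  · simp

/-- If `∂f/∂s = ψ` and `∂f/∂r = ψ` in integrated form, then `f` is constant along `s + r = a`. -/
lemma eq_of_deriv_eq_of_integral_eq (f ψ : ℝ≥0 → ℝ≥0 → ℝ)
    (h1 : ∀ r s : ℝ≥0, HasDerivWithinAt (fun x : ℝ => f x.toNNReal r) (ψ s r) (Ici 0) s)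
    (h2 : ∀ s r₁ r₂ : ℝ≥0, r₁ ≤ r₂ → f s r₂ - f s r₁ = ∫ ρ in (r₁ : ℝ)..r₂, ψ s ρ.toNNReal)
    (hb : ∀ S : ℝ≥0, ∃ C, ∀ s ≤ S, ∀ r, |ψ s r| ≤ C) (a : ℝ≥0) : f a 0 = f 0 a := by
  let F : ℝ → ℝ → ℝ := fun s r => f s.toNNReal r.toNNReal
  let G : ℝ → ℝ → ℝ := fun s r => ψ s.toNNReal r.toNNReal
  have hmax : ∀ x : ℝ, (max x 0).toNNReal = x.toNNReal := fun x => by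
    rw [← Real.coe_toNNReal', Real.toNNReal_coe]
  have hFs : ∀ r, Continuous fun s => F s r := by
    intro r
    have hc : ContinuousOn (fun x : ℝ => f x.toNNReal r.toNNReal) (Ici 0) := fun x hx => by
      have := (h1 r.toNNReal x.toNNReal).continuousWithinAt
      rwa [Real.coe_toNNReal x hx] at this
    have := hc.comp_continuous (f := fun x : ℝ => max x 0) (by fun_prop) fun x => le_max_right x 0
    simpa only [F, Function.comp_def, hmax] using this
  have hG : ∀ s, ∃ C, ∀ s' ≤ s, ∀ r, |G s' r| ≤ C := fun s => by
    obtain ⟨C, hC⟩ := hb s.toNNReal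
    exact ⟨C, fun s' hs' r => hC _ (Real.toNNReal_le_toNNReal hs') _⟩
  have hFr : ∀ s, Continuous fun r => F s r := by
    intro s
    obtain ⟨C, hC⟩ := hb s.toNNReal
    have hC0 : 0 ≤ C := (abs_nonneg _).trans (hC _ le_rfl 0)
    have key : ∀ r₁ r₂ : ℝ≥0, r₁ ≤ r₂ → |f s.toNNReal r₂ - f s.toNNReal r₁| ≤ C * dist r₁ r₂ := by
      intro r₁ r₂ hr
      rw [h2 _ _ _ hr, NNReal.dist_eq, abs_sub_comm]
      exact intervalIntegral.norm_integral_le_of_norm_le_const (C := C)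
        (f := fun ρ : ℝ => ψ s.toNNReal ρ.toNNReal) fun x _ => hC _ le_rfl x.toNNReal
    have hlip : LipschitzWith C.toNNReal (f s.toNNReal) := by
      refine LipschitzWith.of_dist_le_mul fun r₁ r₂ => ?_
      rw [Real.coe_toNNReal _ hC0]
      rcases le_total r₁ r₂ with h | h
      · rw [dist_comm]; exact key _ _ h
      · rw [dist_comm r₁ r₂]; exact key _ _ h
    exact hlip.continuous.comp continuous_real_toNNReal
  have hFm : Measurable (Function.uncurry F) :=
    measurable_uncurry_of_continuous_of_measurable (u := F)
      (fun r => hFs r) fun s => (hFr s).measurable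
  have hd : ∀ r s, 0 ≤ s → HasDerivWithinAt (fun x => F x r) (G s r) (Ici 0) s := fun r s hs => by
    have := h1 r.toNNReal s.toNNReal
    rwa [Real.coe_toNNReal s hs] at this
  -- No measurability of `ψ` is assumed: `G` is a pointwise limit of right difference quotients of
  -- the jointly measurable `F`. The base point is clipped at `0` because the derivative is only
  -- given on `[0, ∞)`.
  have hGm : Measurable (Function.uncurry G) := by
    refine measurable_of_tendsto_metrizable
      (f := fun (n : ℕ) (z : ℝ × ℝ) =>
        ((1 : ℝ) / (n + 1))⁻¹ * (F (max z.1 0 + 1 / (n + 1)) z.2 - F (max z.1 0) z.2)) ?_ ?_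
    · intro n
      have ha : Measurable fun z : ℝ × ℝ => F (max z.1 0 + 1 / (n + 1)) z.2 :=
        hFm.comp (((measurable_fst.max measurable_const).add_const _).prodMk measurable_snd)
      have hb : Measurable fun z : ℝ × ℝ => F (max z.1 0) z.2 :=
        hFm.comp ((measurable_fst.max measurable_const).prodMk measurable_snd)
      exact (ha.sub hb).const_mul _
    · rw [tendsto_pi_nhds]
      rintro ⟨s, r⟩
      have h := hasDerivWithinAt_iff_tendsto_slope.1 (hd r (max s 0) (le_max_right _ _))
      have hseq : Tendsto (fun n : ℕ => max s 0 + 1 / ((n : ℝ) + 1)) atTop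
          (𝓝[Ici 0 \ {max s 0}] (max s 0)) := by
        refine tendsto_nhdsWithin_iff.2 ⟨?_, Eventually.of_forall fun n => ?_⟩
        · simpa using tendsto_one_div_add_atTop_nhds_zero_nat.const_add (max s 0)
        · have hn : (0 : ℝ) < 1 / ((n : ℝ) + 1) := by positivity
          refine ⟨?_, ?_⟩
          · have := le_max_right s 0
            simp only [mem_Ici]
            linarith
          · simp only [mem_singleton_iff, add_eq_left]
            exact hn.ne'
      have := h.comp hseq
      simp only [Function.comp_def, slope_def_module, add_sub_cancel_left, smul_eq_mul] at this
      convert! this using 2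
      simp only [Function.uncurry, G, hmax]
  have hGint : ∀ r, ∀ b, 0 ≤ b → IntervalIntegrable (fun s => G s r) volume 0 b := by
    intro r b hb0
    obtain ⟨C, hC⟩ := hG b
    rw [intervalIntegrable_iff_integrableOn_Ioc_of_le hb0]
    refine Integrable.of_bound (hGm.comp (measurable_id.prodMk measurable_const)).aestronglyMeasurable
      C ?_
    exact (ae_restrict_iff' measurableSet_Ioc).2 (Eventually.of_forall fun s hs => hC s hs.2 r)
  have hs_int : ∀ r b, 0 ≤ b → ∫ s in (0 : ℝ)..b, G s r = F b r - F 0 r := fun r b hb0 => by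
    refine intervalIntegral.integral_eq_sub_of_hasDeriv_right (hFs r).continuousOn
      (fun s hs => ?_) (hGint r b hb0)
    rw [min_eq_left hb0] at hs
    exact (hd r s hs.1.le).mono fun x hx => hs.1.le.trans (le_of_lt hx)
  have hr_int : ∀ s b, 0 ≤ b → ∫ r in (0 : ℝ)..b, G s r = F s b - F s 0 := fun s b hb0 => by
    have := h2 s.toNNReal 0 b.toNNReal zero_le
    rw [Real.coe_toNNReal b hb0, NNReal.coe_zero] at this
    simp only [F, G, Real.toNNReal_zero, this]
  -- Integrate `G` over the triangle in both orders. The inner integrals are increments of `F` from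
  -- an axis to the hypotenuse; the hypotenuse terms agree after `ρ ↦ b - ρ` and cancel. This avoids
  -- differentiating along the diagonal.
  have main : ∀ b : ℝ, 0 ≤ b → ∫ σ in (0 : ℝ)..b, F σ 0 = ∫ ρ in (0 : ℝ)..b, F 0 ρ := by
    intro b hb0
    obtain ⟨C, hC⟩ := hG b
    have hC0 : 0 ≤ C := (abs_nonneg _).trans (hC b le_rfl 0)
    have d1 : ∀ σ ∈ uIcc 0 b, ∫ ρ in (0 : ℝ)..b - σ, G σ ρ = F σ (b - σ) - F σ 0 := by
      intro σ hσ
      rw [uIcc_of_le hb0] at hσ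
      exact hr_int σ _ (by linarith [hσ.2])
    have d2 : ∀ ρ ∈ uIcc 0 b, ∫ σ in (0 : ℝ)..b - ρ, G σ ρ = F (b - ρ) ρ - F 0 ρ := by
      intro ρ hρ
      rw [uIcc_of_le hb0] at hρ
      exact hs_int ρ _ (by linarith [hρ.2])
    have hsum := integral_triangle_swap G hGm b C hb0 fun σ hσ ρ _ => hC σ hσ.2 ρ
    rw [intervalIntegral.integral_congr d1, intervalIntegral.integral_congr d2] at hsum
    have i0 : IntervalIntegrable (fun σ => F σ 0) volume 0 b := (hFs 0).intervalIntegrable _ _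
    have i0' : IntervalIntegrable (fun ρ => F 0 ρ) volume 0 b := (hFr 0).intervalIntegrable _ _
    -- The increment away from the axis is an integral of `G`, hence bounded by `C * b`.
    have i1 : IntervalIntegrable (fun σ => F σ (b - σ)) volume 0 b := by
      have hm : Measurable fun σ => F σ (b - σ) - F σ 0 :=
        (hFm.comp (measurable_id.prodMk (measurable_const.sub measurable_id))).sub
          (hFs 0).measurable
      have : IntervalIntegrable (fun σ => F σ (b - σ) - F σ 0) volume 0 b := by
        rw [intervalIntegrable_iff_integrableOn_Ioc_of_le hb0]
        refine Integrable.of_bound hm.aestronglyMeasurable (C * b) ?_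
        refine (ae_restrict_iff' measurableSet_Ioc).2 (Eventually.of_forall fun σ hσ => ?_)
        rw [← d1 σ (by rw [uIcc_of_le hb0]; exact Ioc_subset_Icc_self hσ)]
        refine (intervalIntegral.norm_integral_le_of_norm_le_const fun ρ _ => ?_).trans
          (mul_le_mul_of_nonneg_left (?_ : |b - σ - 0| ≤ b) hC0)
        · rw [Real.norm_eq_abs]
          exact hC σ hσ.2 ρ
        · rw [sub_zero, abs_of_nonneg (by linarith [hσ.2])]
          linarith [hσ.1]
      simpa using this.add i0
    have hflip := intervalIntegral.integral_comp_sub_left (a := 0) (b := b)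
      (fun x => F (b - x) x) b
    simp only [sub_sub_cancel, sub_self, sub_zero] at hflip
    have i2 : IntervalIntegrable (fun ρ => F (b - ρ) ρ) volume 0 b := by
      simpa using (i1.comp_sub_left b).symm
    rw [intervalIntegral.integral_sub i1 i0, intervalIntegral.integral_sub i2 i0', hflip] at hsum
    linarith
  have ha : (0 : ℝ) ≤ a := a.2
  -- Differentiating `main` in `b` at `a` recovers the pointwise identity; only `b ≥ 0` is
  -- available, hence derivatives within `Ici 0`.
  have e1 := ((hFs 0).integral_hasStrictDerivAt 0 (a : ℝ)).hasDerivAt.hasDerivWithinAt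
    (s := Ici (0 : ℝ))
  have e2 := ((hFr 0).integral_hasStrictDerivAt 0 (a : ℝ)).hasDerivAt.hasDerivWithinAt
    (s := Ici (0 : ℝ))
  have e3 := e2.congr (fun b hb => main b hb) (main a ha)
  have := (uniqueDiffOn_Ici (0 : ℝ) _ ha).eq_deriv _ e1 e3
  simpa [F] using this

end Characteristics

/-! ### The moment formula for arbitrary solutions under the bound -/

section MomentFormula

variable {E : Type*} [TopologicalSpace E] [PolishSpace E] [MeasurableSpace E] [BorelSpace E]
variable {Ω : Type*} {mΩ : MeasurableSpace Ω}
variable {D : Submodule ℝ (E →ᵇ ℝ)} {L : PolyD D →ₗ[ℝ] MPoly E} {ν : ProbabilityMeasure E}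
  {ℱ : Filtration ℝ≥0 mΩ} {ℙ : Measure Ω} {X : ℝ≥0 → Ω → ProbabilityMeasure E}

lemma IsSolution.measurable (hX : IsSolution D L ν ℱ ℙ X) (t : ℝ≥0) : Measurable (X t) :=
  (hX.adapted t).mono (ℱ.le t) le_rfl

/-- Replace `s` by the next point strictly to its right on the grid of mesh `1 / (n + 1)`;
right-continuity gives convergence. -/
lemma measurable_uncurry_of_right_continuous {Z : ℝ≥0 → Ω → ℝ} (hZ : ∀ t, Measurable (Z t))
    (hr : ∀ ω t, ContinuousWithinAt (fun s => Z s ω) (Ici t) t) :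
    Measurable (Function.uncurry Z) := by
  obtain ⟨a, ha⟩ : ∃ a : ℕ → ℕ → ℝ≥0, ∀ n m, a n m = ((m : ℝ≥0) + 1) / ((n : ℝ≥0) + 1) :=
    ⟨_, fun _ _ => rfl⟩
  refine measurable_of_tendsto_metrizable
    (f := fun (n : ℕ) (z : ℝ≥0 × Ω) => Z (a n ⌊z.1 * (n + 1)⌋₊) z.2) (fun n => ?_) ?_
  · have h1 : Measurable fun y : ℕ × Ω => Z (a n y.1) y.2 :=
      measurable_from_prod_countable_right fun m => hZ (a n m)
    have h2 : Measurable fun z : ℝ≥0 × Ω => (⌊z.1 * (n + 1)⌋₊, z.2) :=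
      (Nat.measurable_floor.comp (measurable_fst.mul_const _)).prodMk measurable_snd
    exact h1.comp h2
  · rw [tendsto_pi_nhds]
    rintro ⟨s, ω⟩
    have hlow : ∀ n : ℕ, s ≤ a n ⌊s * (n + 1)⌋₊ := fun n => by
      rw [ha, le_div_iff₀ (by positivity)]
      exact (Nat.lt_floor_add_one _).le
    have hup : ∀ n : ℕ, a n ⌊s * (n + 1)⌋₊ ≤ s + 1 / ((n : ℝ≥0) + 1) := fun n => by
      rw [ha, div_le_iff₀ (by positivity), add_mul, one_div, inv_mul_cancel₀ (by positivity)]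
      gcongr
      exact Nat.floor_le zero_le
    have hlim : Tendsto (fun n : ℕ => a n ⌊s * (n + 1)⌋₊) atTop (𝓝[≥] s) := by
      refine tendsto_nhdsWithin_iff.2 ⟨?_, Eventually.of_forall hlow⟩
      refine tendsto_of_tendsto_of_tendsto_of_le_of_le tendsto_const_nhds ?_ hlow hup
      have : Tendsto (fun n : ℕ => 1 / ((n : ℝ≥0) + 1)) atTop (𝓝 0) :=
        tendsto_one_div_add_atTop_nhds_zero_nat
      simpa using this.const_add s
    exact (hr ω s).tendsto.comp hlim

lemma IsSolution.measurable_uncurry_pairing (hX : IsSolution D L ν ℱ ℙ X) {k : ℕ}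
    (h : (Fin k → E) →ᵇ ℝ) : Measurable fun z : ℝ≥0 × Ω => pairing h (X z.1 z.2) :=
  measurable_uncurry_of_right_continuous (Z := fun t ω => pairing h (X t ω))
    (fun t => (measurable_pairing h).comp (hX.measurable t))
    fun ω t => (continuous_pairing h).continuousAt.comp_continuousWithinAt
      (hX.right_continuous ω t)

lemma IsSolution.integrable_pairing [IsFiniteMeasure ℙ] (hX : IsSolution D L ν ℱ ℙ X) {k : ℕ}
    (h : (Fin k → E) →ᵇ ℝ) (t : ℝ≥0) : Integrable (fun ω => pairing h (X t ω)) ℙ :=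
  Integrable.of_bound ((measurable_pairing h).comp (hX.measurable t)).aestronglyMeasurable ‖h‖
    (Eventually.of_forall fun ω => abs_pairing_le h (X t ω))

lemma abs_setIntegral_pairing_le [IsProbabilityMeasure ℙ] {k : ℕ} (h : (Fin k → E) →ᵇ ℝ)
    (A : Set Ω) (Y : Ω → ProbabilityMeasure E) :
    |∫ ω in A, pairing h (Y ω) ∂ℙ| ≤ ‖h‖ := by
  have := norm_setIntegral_le_of_norm_le_const (μ := ℙ) (s := A) (f := fun ω => pairing h (Y ω))
    (C := ‖h‖) (measure_lt_top _ _) fun ω _ => abs_pairing_le h (Y ω)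
  exact this.trans (mul_le_of_le_one_right (norm_nonneg _) measureReal_le_one)

lemma IsSolution.setIntegral_pairing_sub [IsProbabilityMeasure ℙ] (hX : IsSolution D L ν ℱ ℙ X)
    {k : ℕ} (g h : (Fin k → E) →ᵇ ℝ) (A : Set Ω) (t : ℝ≥0) :
    ∫ ω in A, pairing (g - h) (X t ω) ∂ℙ =
      ∫ ω in A, pairing g (X t ω) ∂ℙ - ∫ ω in A, pairing h (X t ω) ∂ℙ := by
  rw [← integral_sub (hX.integrable_pairing g t).integrableOn
    (hX.integrable_pairing h t).integrableOn]
  simp only [pairing_sub]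

lemma IsSolution.measurable_uncurry_toNNReal (hX : IsSolution D L ν ℱ ℙ X) {k : ℕ}
    (h : (Fin k → E) →ᵇ ℝ) :
    Measurable fun z : ℝ × Ω => pairing h (X z.1.toNNReal z.2) :=
  (hX.measurable_uncurry_pairing h).comp
    ((measurable_real_toNNReal.comp measurable_fst).prodMk measurable_snd)

lemma IsSolution.intervalIntegrable_pairing (hX : IsSolution D L ν ℱ ℙ X) {k : ℕ}
    (h : (Fin k → E) →ᵇ ℝ) (ω : Ω) (a b : ℝ) :
    IntervalIntegrable (fun s : ℝ => pairing h (X s.toNNReal ω)) volume a b := by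
  refine (intervalIntegrable_const (c := ‖h‖)).mono_fun ?_ ?_
  · exact ((hX.measurable_uncurry_toNNReal h).comp
      (measurable_id.prodMk measurable_const)).aestronglyMeasurable
  · exact Eventually.of_forall fun s => by
      simpa using abs_pairing_le h (X s.toNNReal ω)

lemma IsSolution.integrable_prod_pairing [IsProbabilityMeasure ℙ] (hX : IsSolution D L ν ℱ ℙ X)
    {k : ℕ} (h : (Fin k → E) →ᵇ ℝ) (A : Set Ω) (a b : ℝ) :
    Integrable (fun z : ℝ × Ω => pairing h (X z.1.toNNReal z.2))
      ((volume.restrict (uIoc a b)).prod (ℙ.restrict A)) := by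
  have : IsFiniteMeasure ((volume : Measure ℝ).restrict (uIoc a b)) := by
    rw [uIoc]
    infer_instance
  exact Integrable.of_bound (hX.measurable_uncurry_toNNReal h).aestronglyMeasurable ‖h‖
    (Eventually.of_forall fun z => abs_pairing_le h (X z.1.toNNReal z.2))

lemma IsSolution.intervalIntegrable_setIntegral [IsProbabilityMeasure ℙ]
    (hX : IsSolution D L ν ℱ ℙ X) {k : ℕ} (h : (Fin k → E) →ᵇ ℝ) (A : Set Ω) (a b : ℝ) :
    IntervalIntegrable (fun s : ℝ => ∫ ω in A, pairing h (X s.toNNReal ω) ∂ℙ) volume a b := by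
  rw [intervalIntegrable_iff]
  exact (hX.integrable_prod_pairing h A a b).integral_prod_left

/-- The martingale property tested on `A`, with Fubini moving the time integral outside. -/
lemma IsSolution.setIntegral_sub_of_mem_dualGraph [IsProbabilityMeasure ℙ]
    (hX : IsSolution D L ν ℱ ℙ X) {k : ℕ} {gh : ((Fin k → E) →ᵇ ℝ) × ((Fin k → E) →ᵇ ℝ)}
    (hgh : gh ∈ dualGraph D L k) {r₁ r₂ : ℝ≥0} (hr : r₁ ≤ r₂) {A : Set Ω}
    (hA : MeasurableSet[ℱ r₁] A) :
    ∫ ω in A, pairing gh.1 (X r₂ ω) ∂ℙ - ∫ ω in A, pairing gh.1 (X r₁ ω) ∂ℙ =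
      ∫ ρ in (r₁ : ℝ)..r₂, ∫ ω in A, pairing gh.2 (X ρ.toNNReal ω) ∂ℙ := by
  obtain ⟨-, -, p, hp, hL⟩ := hgh
  have hM := hX.martingale p
  have hMA := hM.setIntegral_eq hr hA
  simp only [hp, hL, monomial_toM] at hM hMA
  have h1 := (hM.integrable r₁).integrableOn (s := A)
  have h2 := (hM.integrable r₂).integrableOn (s := A)
  rw [eq_comm, ← sub_eq_zero, ← integral_sub h2 h1] at hMA
  have hpt : ∀ ω, (pairing gh.1 (X r₂ ω) - pairing gh.1 (X 0 ω) -
        ∫ s in (0 : ℝ)..r₂, pairing gh.2 (X s.toNNReal ω)) -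
      (pairing gh.1 (X r₁ ω) - pairing gh.1 (X 0 ω) -
        ∫ s in (0 : ℝ)..r₁, pairing gh.2 (X s.toNNReal ω)) =
      (pairing gh.1 (X r₂ ω) - pairing gh.1 (X r₁ ω)) -
        ∫ s in (r₁ : ℝ)..r₂, pairing gh.2 (X s.toNNReal ω) := fun ω => by
    rw [← intervalIntegral.integral_interval_sub_left
      (hX.intervalIntegrable_pairing gh.2 ω 0 r₂) (hX.intervalIntegrable_pairing gh.2 ω 0 r₁)]
    ring
  simp only [hpt] at hMA
  have i1 := (hX.integrable_pairing gh.1 r₁).integrableOn (s := A)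
  have i2 := (hX.integrable_pairing gh.1 r₂).integrableOn (s := A)
  have hprod := hX.integrable_prod_pairing gh.2 A r₁ r₂
  have i3 : IntegrableOn (fun ω => ∫ s in (r₁ : ℝ)..r₂, pairing gh.2 (X s.toNNReal ω)) A ℙ := by
    have := hprod.integral_prod_right
    simpa [IntegrableOn, intervalIntegral.integral_of_le (NNReal.coe_le_coe.2 hr),
      uIoc_of_le (NNReal.coe_le_coe.2 hr)] using this
  have i21 : IntegrableOn (fun ω => pairing gh.1 (X r₂ ω) - pairing gh.1 (X r₁ ω)) A ℙ := i2.sub i1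
  rw [integral_sub i21 i3, integral_sub i2 i1, sub_eq_zero] at hMA
  rw [hMA, intervalIntegral_integral_swap hprod]

/-- Both sides are Lipschitz in the sup norm, so the identity survives closing the graph. This makes
it usable for `u(s, ·)`, which need not lie in `D^{⊗k}`. -/
lemma IsSolution.setIntegral_sub_of_mem_closure [IsProbabilityMeasure ℙ]
    (hX : IsSolution D L ν ℱ ℙ X) {k : ℕ} {gh : ((Fin k → E) →ᵇ ℝ) × ((Fin k → E) →ᵇ ℝ)}
    (hgh : gh ∈ closure (dualGraph D L k : Set (((Fin k → E) →ᵇ ℝ) × ((Fin k → E) →ᵇ ℝ))))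
    {r₁ r₂ : ℝ≥0} (hr : r₁ ≤ r₂) {A : Set Ω} (hA : MeasurableSet[ℱ r₁] A) :
    ∫ ω in A, pairing gh.1 (X r₂ ω) ∂ℙ - ∫ ω in A, pairing gh.1 (X r₁ ω) ∂ℙ =
      ∫ ρ in (r₁ : ℝ)..r₂, ∫ ω in A, pairing gh.2 (X ρ.toNNReal ω) ∂ℙ := by
  have hc : ∀ r, Continuous fun g : (Fin k → E) →ᵇ ℝ => ∫ ω in A, pairing g (X r ω) ∂ℙ := by
    intro r
    refine (LipschitzWith.of_dist_le_mul (K := 1) fun g g' => ?_).continuous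
    rw [Real.dist_eq, ← hX.setIntegral_pairing_sub, dist_eq_norm, NNReal.coe_one, one_mul]
    exact abs_setIntegral_pairing_le _ _ _
  have hc' : Continuous fun h : (Fin k → E) →ᵇ ℝ =>
      ∫ ρ in (r₁ : ℝ)..r₂, ∫ ω in A, pairing h (X ρ.toNNReal ω) ∂ℙ := by
    refine (LipschitzWith.of_dist_le_mul (K := r₂ - r₁) fun g g' => ?_).continuous
    rw [Real.dist_eq, ← intervalIntegral.integral_sub (hX.intervalIntegrable_setIntegral _ _ _ _)
      (hX.intervalIntegrable_setIntegral _ _ _ _), dist_eq_norm, NNReal.coe_sub hr, mul_comm]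
    refine (intervalIntegral.norm_integral_le_of_norm_le_const (C := ‖g - g'‖)
      (f := fun ρ : ℝ => ∫ ω in A, pairing g (X ρ.toNNReal ω) ∂ℙ -
        ∫ ω in A, pairing g' (X ρ.toNNReal ω) ∂ℙ) fun ρ _ => ?_).trans ?_
    · rw [← hX.setIntegral_pairing_sub]
      exact abs_setIntegral_pairing_le _ _ _
    · rw [abs_of_nonneg (sub_nonneg.2 (NNReal.coe_le_coe.2 hr))]
  exact closure_minimal (fun z hz => hX.setIntegral_sub_of_mem_dualGraph hz hr hA)
    (isClosed_eq (((hc r₂).comp continuous_fst).sub ((hc r₁).comp continuous_fst))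
      (hc'.comp continuous_snd)) hgh

/-- The mean value inequality at each point `y`, with a constant independent of `y`, upgrades
pointwise differentiability to a Lipschitz estimate in norm. -/
lemma SolvesPIDE.norm_sub_le {Y : Type*} [TopologicalSpace Y] {A : (Y →ᵇ ℝ) →ₗ.[ℝ] (Y →ᵇ ℝ)}
    {g : Y →ᵇ ℝ} {u : ℝ≥0 → (Y →ᵇ ℝ)} (hu : SolvesPIDE A g u) {S : ℝ≥0} {C : ℝ}
    (hC : ∀ t ≤ S, ∀ h : u t ∈ A.domain, ‖A ⟨u t, h⟩‖ ≤ C) {a b : ℝ≥0} (ha : a ≤ S) (hb : b ≤ S) :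
    ‖u b - u a‖ ≤ C * |(b : ℝ) - a| := by
  have hC0 : 0 ≤ C := (norm_nonneg _).trans (hC a ha (hu.mem_domain a))
  refine (BoundedContinuousFunction.norm_le (by positivity)).2 fun y => ?_
  have hmem : ∀ c : ℝ≥0, c ≤ S → (c : ℝ) ∈ Icc (0 : ℝ) S := fun c hc =>
    ⟨c.2, NNReal.coe_le_coe.2 hc⟩
  have := (convex_Icc (0 : ℝ) S).norm_image_sub_le_of_norm_hasDerivWithin_le (C := C)
    (f := fun s : ℝ => u s.toNNReal y)
    (f' := fun s : ℝ => A ⟨u s.toNNReal, hu.mem_domain _⟩ y) (fun s hs => ?_) (fun s hs => ?_)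
    (hmem a ha) (hmem b hb)
  · simpa using this
  · have h := hu.deriv_eq s.toNNReal y
    rw [Real.coe_toNNReal s hs.1] at h
    exact h.mono Icc_subset_Ici_self
  · exact ((A ⟨u s.toNNReal, hu.mem_domain _⟩).norm_coe_le_norm y).trans
      (hC _ (Real.toNNReal_le_iff_le_coe.2 hs.2) _)

theorem IsSolution.momentFormula [IsProbabilityMeasure ℙ] (hX : IsSolution D L ν ℱ ℙ X) {k : ℕ}
    (hcl : (dualOp D L k).IsClosable) {g : (Fin k → E) →ᵇ ℝ} {u : ℝ≥0 → ((Fin k → E) →ᵇ ℝ)}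
    (hu : SolvesPIDE (dualOp D L k).closure g u)
    (hb : LocallyBoundedImage (dualOp D L k).closure u) : MomentFormula ℱ ℙ X g u := by
  intro t T htT
  have hE : Nonempty E := ν.nonempty
  refine (ae_eq_condExp_of_forall_setIntegral_eq (ℱ.le t) (hX.integrable_pairing g T)
    (fun _ _ _ => (hX.integrable_pairing _ t).integrableOn) (fun A hA _ => ?_)
    ((measurable_pairing _).comp (hX.adapted t)).stronglyMeasurable.aestronglyMeasurable).symm
  let v : ℝ≥0 → ((Fin k → E) →ᵇ ℝ) := fun s => (dualOp D L k).closure ⟨u s, hu.mem_domain s⟩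
  have key := eq_of_deriv_eq_of_integral_eq
    (fun s r => ∫ ω in A, pairing (u s) (X (t + r) ω) ∂ℙ)
    (fun s r => ∫ ω in A, pairing (v s) (X (t + r) ω) ∂ℙ) ?_ ?_ ?_ (T - t)
  · simpa [hu.initial, add_tsub_cancel_of_le htT] using key
  · intro r s
    -- The horizon `s + 1` leaves room for a neighbourhood of radius `1` on both sides of `s`.
    obtain ⟨C, hC⟩ := hb (s + 1)
    have hlip : ∀ x ∈ Ici (0 : ℝ), |x - s| < 1 → ‖u x.toNNReal - u s‖ ≤ C * |x - s| := by
      intro x hx hxs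
      have := hu.norm_sub_le hC (a := s) (b := x.toNNReal) (by simp) (by
        rw [Real.toNNReal_le_iff_le_coe]
        push_cast
        linarith [(abs_lt.1 hxs).2])
      rwa [Real.coe_toNNReal x hx] at this
    refine hasDerivWithinAt_integral_of_lipschitz (ℙ.restrict A)
      (fun x ω => pairing (u x.toNNReal) (X (t + r) ω)) _ s C 1 one_pos
      (fun x => (hX.integrable_pairing _ _).integrableOn) ?_ fun ω => ?_
    · intro x hx hxs ω
      simp only [Real.toNNReal_coe]
      exact (abs_pairing_sub_le _ _ _).trans (hlip x hx hxs)
    -- The derivative passes under two integrals, over `Ω` and then over `E^k`, with the same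
    -- Lipschitz constant.
    · refine hasDerivWithinAt_integral_of_lipschitz (Measure.pi fun _ => (X (t + r) ω : Measure E))
        (fun x y => u x.toNNReal y) _ s C 1 one_pos (fun x => integrable_pi _ _) ?_ fun y => ?_
      · intro x hx hxs y
        simp only [Real.toNNReal_coe]
        exact ((u x.toNNReal - u s).norm_coe_le_norm y).trans (hlip x hx hxs)
      · exact hu.deriv_eq s y
  · intro s r₁ r₂ hr
    have := hX.setIntegral_sub_of_mem_closure
      (mem_closure_dualGraph D L k hE hcl ⟨u s, hu.mem_domain s⟩) (add_le_add_right hr t)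
      (ℱ.mono (le_add_of_nonneg_right zero_le) A hA)
    simp only at this ⊢
    rw [this]
    push_cast
    rw [← intervalIntegral.integral_comp_add_left]
    refine intervalIntegral.integral_congr fun ρ hρ => ?_
    rw [uIcc_of_le (NNReal.coe_le_coe.2 hr)] at hρ
    have : ((t : ℝ) + ρ).toNNReal = t + ρ.toNNReal := by
      rw [Real.toNNReal_add t.coe_nonneg (r₁.coe_nonneg.trans hρ.1), Real.toNNReal_coe]
    simp only [v, this]
  · intro S
    obtain ⟨C, hC⟩ := hb S
    exact ⟨C, fun s hs r => (abs_setIntegral_pairing_le _ _ _).trans (hC s hs _)⟩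

end MomentFormula

/-! ### Algebras spanned by powers -/

section Polarization

variable {A : Type*} [CommRing A] [Algebra ℝ A]

/-- Polarization: a subspace that contains the `n`-th powers of the elements of `V` contains the
products `a ^ i * b ^ j` with `a, b ∈ V` and `i + j = n`. -/
lemma pow_mul_pow_mem {V W : Submodule ℝ A} {n : ℕ} (h : ∀ a ∈ V, a ^ n ∈ W) {a b : A}
    (ha : a ∈ V) (hb : b ∈ V) {i j : ℕ} (hij : i + j = n) : a ^ i * b ^ j ∈ W := by
  -- A linear functional killing `W` but not the product turns `(c • a + b) ^ n ∈ W` into a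
  -- polynomial in `c` that vanishes identically; its coefficient at `c ^ i` is a nonzero multiple
  -- of the value at the product.
  by_contra hmem
  obtain ⟨φ, hφ, hW⟩ := Submodule.exists_le_ker_of_notMem hmem
  let P : Polynomial ℝ := ∑ m ∈ Finset.range (n + 1),
    Polynomial.monomial m (φ (a ^ m * b ^ (n - m)) * (n.choose m : ℝ))
  have hP : P = 0 := by
    refine Polynomial.funext fun c => ?_
    have h0 : φ ((c • a + b) ^ n) = 0 := hW (h _ (V.add_mem (V.smul_mem c ha) hb))
    rw [Polynomial.eval_zero, ← h0, add_pow, map_sum, Polynomial.eval_finsetSum]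
    refine Finset.sum_congr rfl fun m _ => ?_
    rw [Polynomial.eval_monomial, smul_pow, smul_mul_assoc, smul_mul_assoc, map_smul, smul_eq_mul,
      ← nsmul_eq_mul' (a ^ m * b ^ (n - m)) (n.choose m), map_nsmul, nsmul_eq_mul]
    ring
  have hcoef : P.coeff i = 0 := by rw [hP, Polynomial.coeff_zero]
  simp only [P, Polynomial.finsetSum_coeff, Polynomial.coeff_monomial] at hcoef
  rw [Finset.sum_ite_eq' , if_pos (by simp; omega), mul_eq_zero] at hcoef
  rcases hcoef with h1 | h1
  · rw [show n - i = j by omega] at h1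
    exact hφ h1
  · exact (Nat.choose_pos (by omega : i ≤ n)).ne' (by exact_mod_cast h1)

/-- By polarization `a ^ k * b ^ l` is a combination of `(k + l)`-th powers, so the span of powers
is closed under products. This is needed because conditional expectation is linear but not
multiplicative, and the moment formula directly covers only powers. -/
lemma adjoin_le_span_pow {V : Submodule ℝ A} (h1 : (1 : A) ∈ V) {x : A}
    (hx : x ∈ Algebra.adjoin ℝ (V : Set A)) :
    x ∈ Submodule.span ℝ {y : A | ∃ k : ℕ, 1 ≤ k ∧ ∃ a ∈ V, y = a ^ k} := by
  set W := Submodule.span ℝ {y : A | ∃ k : ℕ, 1 ≤ k ∧ ∃ a ∈ V, y = a ^ k}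
  have hpow : ∀ k : ℕ, 1 ≤ k → ∀ a ∈ V, a ^ k ∈ W := fun k hk a ha =>
    Submodule.subset_span ⟨k, hk, a, ha, rfl⟩
  induction hx using Algebra.adjoin_induction with
  | mem a ha => simpa using hpow 1 le_rfl a ha
  | algebraMap r =>
    rw [Algebra.algebraMap_eq_smul_one]
    exact W.smul_mem r (by simpa using hpow 1 le_rfl 1 h1)
  | add x y _ _ hx hy => exact W.add_mem hx hy
  | mul x y hx' hy' hx hy =>
    clear hx' hy'
    induction hx, hy using Submodule.span_induction₂ with
    | mem_mem x y hx hy =>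
      obtain ⟨k, hk, a, ha, rfl⟩ := hx
      obtain ⟨l, -, b, hb, rfl⟩ := hy
      exact pow_mul_pow_mem (fun a ha => hpow (k + l) (by omega) a ha) ha hb rfl
    | zero_left y _ => simp
    | zero_right x _ => simp
    | add_left x y z _ _ _ h1 h2 => rw [add_mul]; exact W.add_mem h1 h2
    | add_right x y z _ _ _ h1 h2 => rw [mul_add]; exact W.add_mem h1 h2
    | smul_left r x y _ _ h => rw [smul_mul_assoc]; exact W.smul_mem r h
    | smul_right r x y _ _ h => rw [mul_smul_comm]; exact W.smul_mem r h

end Polarization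

/-! ### The algebra of polynomials on `M_1(E)` and its uniform closure -/

section EvalAlgebra

variable {E : Type*} [TopologicalSpace E] [MeasurableSpace E] [OpensMeasurableSpace E]

/-- The map `g ↦ ⟨g, ·⟩`, with values in the functions on `M_1(E)`. -/
noncomputable def evalMap : (E →ᵇ ℝ) →ₗ[ℝ] (ProbabilityMeasure E → ℝ) where
  toFun g μ := ∫ x, g x ∂(μ : Measure E)
  map_add' g h := funext fun _ => integral_add (g.integrable _) (h.integrable _)
  map_smul' c _ := funext fun _ => integral_const_mul c _

lemma evalMap_apply (g : E →ᵇ ℝ) (μ : ProbabilityMeasure E) :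
    evalMap g μ = ∫ x, g x ∂(μ : Measure E) := rfl

lemma evalMap_one : evalMap (1 : E →ᵇ ℝ) = 1 := by
  ext μ
  simp [evalMap_apply]

lemma abs_evalMap_le (g : E →ᵇ ℝ) (μ : ProbabilityMeasure E) : |evalMap g μ| ≤ ‖g‖ :=
  g.norm_integral_le_norm (μ : Measure E)

lemma measurable_evalMap (g : E →ᵇ ℝ) : Measurable (evalMap g) := by
  let κ : ProbabilityTheory.Kernel (ProbabilityMeasure E) E := ⟨_, measurable_subtype_coe⟩
  have : ProbabilityTheory.IsMarkovKernel κ :=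
    ⟨fun μ => inferInstanceAs (IsProbabilityMeasure (μ : Measure E))⟩
  exact (MeasureTheory.StronglyMeasurable.integral_kernel (κ := κ)
    g.continuous.measurable.stronglyMeasurable).measurable

/-- The algebra of functions on `M_1(E)` generated by the functions `⟨g, ·⟩`, `g ∈ D`. -/
def evalAlg (D : Submodule ℝ (E →ᵇ ℝ)) : Subalgebra ℝ (ProbabilityMeasure E → ℝ) :=
  Algebra.adjoin ℝ (D.map evalMap : Set (ProbabilityMeasure E → ℝ))

/-- The functions on `M_1(E)` that are uniform limits of elements of `evalAlg D`. -/
def evalClosure (D : Submodule ℝ (E →ᵇ ℝ)) : Set (ProbabilityMeasure E → ℝ) :=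
  {φ | ∀ ε > 0, ∃ p ∈ evalAlg D, ∀ μ, |φ μ - p μ| ≤ ε}

variable {D : Submodule ℝ (E →ᵇ ℝ)}

lemma evalMap_mem_evalAlg {g : E →ᵇ ℝ} (hg : g ∈ D) : evalMap g ∈ evalAlg D :=
  Algebra.subset_adjoin (Submodule.mem_map_of_mem hg)

lemma evalAlg_measurable_bounded {p : ProbabilityMeasure E → ℝ} (hp : p ∈ evalAlg D) :
    Measurable p ∧ ∃ C, ∀ μ, |p μ| ≤ C := by
  induction hp using Algebra.adjoin_induction with
  | mem a ha =>
    obtain ⟨g, -, rfl⟩ := ha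
    exact ⟨measurable_evalMap g, _, abs_evalMap_le g⟩
  | algebraMap r => exact ⟨measurable_const, |r|, fun μ => le_rfl⟩
  | add p q _ _ hp hq =>
    obtain ⟨hpm, C, hC⟩ := hp
    obtain ⟨hqm, C', hC'⟩ := hq
    exact ⟨hpm.add hqm, C + C', fun μ => (abs_add_le _ _).trans (add_le_add (hC μ) (hC' μ))⟩
  | mul p q _ _ hp hq =>
    obtain ⟨hpm, C, hC⟩ := hp
    obtain ⟨hqm, C', hC'⟩ := hq
    refine ⟨hpm.mul hqm, C * C', fun μ => ?_⟩
    rw [Pi.mul_apply, abs_mul]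
    exact mul_le_mul (hC μ) (hC' μ) (abs_nonneg _) ((abs_nonneg _).trans (hC μ))

lemma evalAlg_subset_evalClosure {p : ProbabilityMeasure E → ℝ} (hp : p ∈ evalAlg D) :
    p ∈ evalClosure D := fun ε hε => ⟨p, hp, fun μ => by simpa using hε.le⟩

lemma evalClosure_measurable {φ : ProbabilityMeasure E → ℝ} (hφ : φ ∈ evalClosure D) :
    Measurable φ := by
  have hpos : ∀ n : ℕ, (0 : ℝ) < 1 / (n + 1) := fun n => by positivity
  choose p hp hpφ using fun n : ℕ => hφ (1 / (n + 1)) (hpos n)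
  refine measurable_of_tendsto_metrizable (fun n => (evalAlg_measurable_bounded (hp n)).1)
    (tendsto_pi_nhds.2 fun μ => ?_)
  rw [tendsto_iff_dist_tendsto_zero]
  refine squeeze_zero (fun _ => dist_nonneg) (fun n => ?_) tendsto_one_div_add_atTop_nhds_zero_nat
  rw [dist_comm, Real.dist_eq]
  exact hpφ n μ

lemma evalClosure_bounded {φ : ProbabilityMeasure E → ℝ} (hφ : φ ∈ evalClosure D) :
    ∃ C, ∀ μ, |φ μ| ≤ C := by
  obtain ⟨p, hp, hpφ⟩ := hφ 1 one_pos
  obtain ⟨C, hC⟩ := (evalAlg_measurable_bounded hp).2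
  refine ⟨1 + C, fun μ => ?_⟩
  have : φ μ = (φ μ - p μ) + p μ := by ring
  rw [this]
  exact (abs_add_le _ _).trans (add_le_add (hpφ μ) (hC μ))

lemma evalClosure_add {φ ψ : ProbabilityMeasure E → ℝ} (hφ : φ ∈ evalClosure D)
    (hψ : ψ ∈ evalClosure D) : φ + ψ ∈ evalClosure D := by
  intro ε hε
  obtain ⟨p, hp, h1⟩ := hφ (ε / 2) (by positivity)
  obtain ⟨q, hq, h2⟩ := hψ (ε / 2) (by positivity)
  refine ⟨p + q, add_mem hp hq, fun μ => ?_⟩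
  have : (φ + ψ) μ - (p + q) μ = (φ μ - p μ) + (ψ μ - q μ) := by
    simp only [Pi.add_apply]
    ring
  rw [this]
  exact (abs_add_le _ _).trans (by linarith [h1 μ, h2 μ])

lemma evalClosure_mul {φ ψ : ProbabilityMeasure E → ℝ} (hφ : φ ∈ evalClosure D)
    (hψ : ψ ∈ evalClosure D) : φ * ψ ∈ evalClosure D := by
  intro ε hε
  obtain ⟨C, hC⟩ := evalClosure_bounded hψ
  -- `p` is fixed before `q`, since the tolerance for `q` depends on the bound of `p`.
  obtain ⟨p, hp, h1⟩ := hφ (ε / 2 / (|C| + 1)) (by positivity)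
  obtain ⟨C', hC'⟩ := (evalAlg_measurable_bounded hp).2
  obtain ⟨q, hq, h2⟩ := hψ (ε / 2 / (|C'| + 1)) (by positivity)
  refine ⟨p * q, mul_mem hp hq, fun μ => ?_⟩
  have : (φ * ψ) μ - (p * q) μ = (φ μ - p μ) * ψ μ + p μ * (ψ μ - q μ) := by
    simp only [Pi.mul_apply]
    ring
  rw [this]
  refine (abs_add_le _ _).trans ?_
  rw [abs_mul, abs_mul]
  have e1 : |φ μ - p μ| * |ψ μ| ≤ ε / 2 / (|C| + 1) * (|C| + 1) :=
    mul_le_mul (h1 μ) (by linarith [hC μ, le_abs_self C]) (abs_nonneg _) (by positivity)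
  have e2 : |p μ| * |ψ μ - q μ| ≤ (|C'| + 1) * (ε / 2 / (|C'| + 1)) :=
    mul_le_mul (by linarith [hC' μ, le_abs_self C']) (h2 μ) (abs_nonneg _) (by positivity)
  rw [div_mul_cancel₀ _ (by positivity)] at e1
  rw [mul_div_cancel₀ _ (by positivity)] at e2
  linarith

lemma evalClosure_smul (c : ℝ) {φ : ProbabilityMeasure E → ℝ} (hφ : φ ∈ evalClosure D) :
    c • φ ∈ evalClosure D := by
  have hc : (fun _ => c : ProbabilityMeasure E → ℝ) ∈ evalAlg D := (evalAlg D).algebraMap_mem c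
  exact evalClosure_mul (evalAlg_subset_evalClosure hc) hφ

lemma evalClosure_one : (1 : ProbabilityMeasure E → ℝ) ∈ evalClosure D :=
  evalAlg_subset_evalClosure (one_mem _)

lemma evalClosure_prod {ι : Type*} (s : Finset ι) {φ : ι → ProbabilityMeasure E → ℝ}
    (hφ : ∀ i ∈ s, φ i ∈ evalClosure D) : ∏ i ∈ s, φ i ∈ evalClosure D :=
  Finset.prod_induction _ (· ∈ evalClosure D) (fun _ _ => evalClosure_mul) evalClosure_one hφ

/-- Continuous functions of `⟨g, ·⟩` are uniform limits of polynomials in `⟨g, ·⟩`. -/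
lemma evalClosure_comp {f : ℝ → ℝ} (hf : Continuous f) {g : E →ᵇ ℝ} (hg : g ∈ D) :
    (fun μ => f (evalMap g μ)) ∈ evalClosure D := by
  intro ε hε
  obtain ⟨P, hP⟩ := exists_polynomial_near_of_continuousOn (-‖g‖) ‖g‖ f hf.continuousOn ε hε
  refine ⟨Polynomial.aeval (evalMap g) P,
    Algebra.adjoin_le (Set.singleton_subset_iff.2 (evalMap_mem_evalAlg hg))
      (Polynomial.aeval_mem_adjoin_singleton ℝ _), fun μ => ?_⟩
  have hev : Polynomial.aeval (evalMap g) P μ = P.eval (evalMap g μ) := by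
    simp
  rw [hev, abs_sub_comm]
  exact (hP _ (abs_le.1 (abs_evalMap_le g μ))).le

variable [SecondCountableTopology E]

/-- The function `(x₁, …, x_k) ↦ g(x₁) ⋯ g(x_k)`. -/
noncomputable def powTensor (g : E →ᵇ ℝ) (k : ℕ) : (Fin k → E) →ᵇ ℝ :=
  ∏ i, g.compContinuous ⟨fun x => x i, continuous_apply i⟩

lemma powTensor_apply (g : E →ᵇ ℝ) (k : ℕ) (x : Fin k → E) :
    powTensor g k x = ∏ i, g (x i) := by
  simp [powTensor]

lemma powTensor_mem {g : E →ᵇ ℝ} (hg : g ∈ D) (k : ℕ) : powTensor g k ∈ tensorPow D k :=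
  Submodule.subset_span ⟨g, hg, powTensor_apply g k⟩

lemma pairing_of_eq_prod {k : ℕ} {f : (Fin k → E) →ᵇ ℝ} {g : E →ᵇ ℝ}
    (hf : ∀ x, f x = ∏ i, g (x i)) (μ : ProbabilityMeasure E) :
    pairing f μ = evalMap g μ ^ k := by
  simp only [pairing, hf, evalMap_apply]
  rw [integral_fintype_prod_eq_prod (fun _ : Fin k => (g : E → ℝ))]
  simp

lemma pairing_mem_evalAlg {k : ℕ} {f : (Fin k → E) →ᵇ ℝ} (hf : f ∈ tensorPow D k) :
    pairing f ∈ evalAlg D := by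
  induction hf using Submodule.span_induction with
  | mem f hf =>
    obtain ⟨g, hg, hfg⟩ := hf
    have : pairing f = evalMap g ^ k := funext fun μ => pairing_of_eq_prod hfg μ
    rw [this]
    exact pow_mem (evalMap_mem_evalAlg hg) k
  | zero =>
    have : pairing (0 : (Fin k → E) →ᵇ ℝ) = 0 := funext fun μ => by simp [pairing]
    rw [this]
    exact zero_mem _
  | add f f' _ _ h h' =>
    have : pairing (f + f') = pairing f + pairing f' := funext fun μ => pairing_add f f' μ
    rw [this]
    exact add_mem h h'
  | smul c f _ h =>
    have : pairing (c • f) = c • pairing f := funext fun μ => pairing_smul c f μ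
    rw [this]
    exact (evalAlg D).smul_mem h c

lemma pairing_mem_evalClosure {k : ℕ} {f : (Fin k → E) →ᵇ ℝ}
    (hf : f ∈ closure (tensorPow D k : Set ((Fin k → E) →ᵇ ℝ))) : pairing f ∈ evalClosure D := by
  intro ε hε
  obtain ⟨g, hg, hfg⟩ := Metric.mem_closure_iff.1 hf ε hε
  rw [dist_eq_norm] at hfg
  exact ⟨pairing g, pairing_mem_evalAlg hg, fun μ => (abs_pairing_sub_le _ _ _).trans hfg.le⟩

end EvalAlgebra

/-! ### Joint expectations by iterated conditioning -/

section Prediction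

variable {E : Type*} [TopologicalSpace E] [MeasurableSpace E] [OpensMeasurableSpace E]
variable {Ω : Type*} {mΩ : MeasurableSpace Ω}
variable {D : Submodule ℝ (E →ᵇ ℝ)}
  {ℱ : Filtration ℝ≥0 mΩ} {ℙ : Measure Ω} {X : ℝ≥0 → Ω → ProbabilityMeasure E}

/-- `q(X_t)` is the conditional expectation of `p(X_{t+s})` given `ℱ_t`, for all `t`. -/
def Predicts (ℱ : Filtration ℝ≥0 mΩ) (ℙ : Measure Ω) (X : ℝ≥0 → Ω → ProbabilityMeasure E)
    (s : ℝ≥0) (p q : ProbabilityMeasure E → ℝ) : Prop :=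
  ∀ t : ℝ≥0, ℙ[fun ω => p (X (t + s) ω) | ℱ t] =ᵐ[ℙ] fun ω => q (X t ω)

lemma integrable_comp_of_mem_evalClosure [IsFiniteMeasure ℙ] (hX : ∀ t, Measurable[ℱ t] (X t))
    {p : ProbabilityMeasure E → ℝ} (hp : p ∈ evalClosure D) (t : ℝ≥0) :
    Integrable (fun ω => p (X t ω)) ℙ := by
  obtain ⟨C, hC⟩ := evalClosure_bounded hp
  exact Integrable.of_bound ((evalClosure_measurable hp).comp
    ((hX t).mono (ℱ.le t) le_rfl)).aestronglyMeasurable C (Eventually.of_forall fun ω => hC _)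

lemma Predicts.add [IsFiniteMeasure ℙ] (hX : ∀ t, Measurable[ℱ t] (X t)) {s : ℝ≥0}
    {p p' q q' : ProbabilityMeasure E → ℝ} (hp : p ∈ evalClosure D) (hp' : p' ∈ evalClosure D)
    (h : Predicts ℱ ℙ X s p q) (h' : Predicts ℱ ℙ X s p' q') :
    Predicts ℱ ℙ X s (p + p') (q + q') := fun t =>
  (condExp_add (integrable_comp_of_mem_evalClosure hX hp _)
    (integrable_comp_of_mem_evalClosure hX hp' _) (ℱ t)).trans ((h t).add (h' t))

lemma Predicts.smul {s : ℝ≥0} (c : ℝ) {p q : ProbabilityMeasure E → ℝ}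
    (h : Predicts ℱ ℙ X s p q) : Predicts ℱ ℙ X s (c • p) (c • q) := fun t =>
  (condExp_smul c (fun ω => p (X (t + s) ω)) (ℱ t)).trans ((h t).const_smul c)

lemma Predicts.integral_mul_eq [IsFiniteMeasure ℙ] (hX : ∀ t, Measurable[ℱ t] (X t)) {s a : ℝ≥0}
    {p q : ProbabilityMeasure E → ℝ} (hp : p ∈ evalClosure D) (h : Predicts ℱ ℙ X s p q)
    {G : Ω → ℝ} (hG : Measurable[ℱ a] G) {C : ℝ} (hGC : ∀ ω, |G ω| ≤ C) :
    ∫ ω, G ω * p (X (a + s) ω) ∂ℙ = ∫ ω, G ω * q (X a ω) ∂ℙ := by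
  have hi := integrable_comp_of_mem_evalClosure hX hp (ℙ := ℙ) (a + s)
  have hGm : StronglyMeasurable[ℱ a] G := hG.stronglyMeasurable
  have hGi : Integrable (G * fun ω => p (X (a + s) ω)) ℙ :=
    hi.bdd_mul (hGm.mono (ℱ.le a)).aestronglyMeasurable (Eventually.of_forall hGC)
  have h1 := condExp_mul_of_stronglyMeasurable_left hGm hGi hi
  calc ∫ ω, G ω * p (X (a + s) ω) ∂ℙ
      = ∫ ω, (ℙ[G * fun ω => p (X (a + s) ω) | ℱ a]) ω ∂ℙ := (integral_condExp (ℱ.le a)).symm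
    _ = ∫ ω, G ω * q (X a ω) ∂ℙ := by
        refine integral_congr_ae (h1.trans ?_)
        filter_upwards [h a] with ω hω
        simp only [Pi.mul_apply, hω]

lemma abs_integral_mul_sub_le [IsProbabilityMeasure ℙ] {Y : Ω → ProbabilityMeasure E}
    (hY : Measurable Y) {G : Ω → ℝ} (hG : Measurable G) {C : ℝ} (hC : ∀ ω, |G ω| ≤ C) {ε : ℝ}
    {φ ψ : ProbabilityMeasure E → ℝ} (hφ : φ ∈ evalClosure D) (hψ : ψ ∈ evalClosure D)
    (h : ∀ μ, |φ μ - ψ μ| ≤ ε) :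
    |∫ ω, G ω * φ (Y ω) ∂ℙ - ∫ ω, G ω * ψ (Y ω) ∂ℙ| ≤ C * ε := by
  have hi : ∀ {θ : ProbabilityMeasure E → ℝ}, θ ∈ evalClosure D →
      Integrable (fun ω => G ω * θ (Y ω)) ℙ := by
    intro θ hθ
    obtain ⟨M, hM⟩ := evalClosure_bounded hθ
    refine Integrable.of_bound
      (hG.mul ((evalClosure_measurable hθ).comp hY)).aestronglyMeasurable (C * M)
      (Eventually.of_forall fun ω => ?_)
    rw [norm_mul]
    exact mul_le_mul (hC ω) (hM _) (norm_nonneg _) ((abs_nonneg _).trans (hC ω))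
  rw [← integral_sub (hi hφ) (hi hψ)]
  have := norm_integral_le_of_norm_le_const (μ := ℙ)
    (f := fun ω => G ω * φ (Y ω) - G ω * ψ (Y ω)) (C := C * ε) (Eventually.of_forall fun ω => by
      rw [← mul_sub, norm_mul]
      exact mul_le_mul (hC ω) (h _) (norm_nonneg _) ((abs_nonneg _).trans (hC ω)))
  simpa using this

variable {Ω' : Type*} {mΩ' : MeasurableSpace Ω'}
  {ℱ' : Filtration ℝ≥0 mΩ'} {ℙ' : Measure Ω'} {X' : ℝ≥0 → Ω' → ProbabilityMeasure E}

/-- Predictions are available for the algebra only, while the functions they produce lie in its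
closure; uniform approximation against bounded `G`, `G'` bridges the gap so that conditioning can be
repeated. -/
lemma integral_mul_eq_of_mem_evalClosure [IsProbabilityMeasure ℙ] [IsProbabilityMeasure ℙ']
    {Y : Ω → ProbabilityMeasure E} {Y' : Ω' → ProbabilityMeasure E} (hY : Measurable Y)
    (hY' : Measurable Y') {G : Ω → ℝ} {G' : Ω' → ℝ} (hG : Measurable G) (hG' : Measurable G')
    {C : ℝ} (hC : ∀ ω, |G ω| ≤ C) (hC' : ∀ ω, |G' ω| ≤ C)
    (h : ∀ p ∈ evalAlg D, ∫ ω, G ω * p (Y ω) ∂ℙ = ∫ ω, G' ω * p (Y' ω) ∂ℙ')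
    {ψ : ProbabilityMeasure E → ℝ} (hψ : ψ ∈ evalClosure D) :
    ∫ ω, G ω * ψ (Y ω) ∂ℙ = ∫ ω, G' ω * ψ (Y' ω) ∂ℙ' := by
  refine eq_of_forall_dist_le fun ε hε => ?_
  have hpos : 0 < ε / (2 * (|C| + 1)) := by positivity
  obtain ⟨p, hp, hψp⟩ := hψ _ hpos
  have hp' := evalAlg_subset_evalClosure hp
  have h1 := abs_integral_mul_sub_le (ℙ := ℙ) hY hG hC hψ hp' hψp
  have h2 := abs_integral_mul_sub_le (ℙ := ℙ') hY' hG' hC' hψ hp' hψp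
  rw [h p hp] at h1
  have h3 : C * (ε / (2 * (|C| + 1))) ≤ ε / 2 := by
    have : ε / 2 = (|C| + 1) * (ε / (2 * (|C| + 1))) := by field_simp
    rw [this]
    exact mul_le_mul_of_nonneg_right (by linarith [le_abs_self C]) hpos.le
  rw [Real.dist_eq]
  have h4 := abs_sub_le (∫ ω, G ω * ψ (Y ω) ∂ℙ) (∫ ω, G' ω * p (Y' ω) ∂ℙ')
    (∫ ω, G' ω * ψ (Y' ω) ∂ℙ')
  rw [abs_sub_comm (∫ ω, G' ω * p (Y' ω) ∂ℙ')] at h4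
  linarith

/-- Two processes with the same deterministic initial value and the same prediction operators have
the same joint expectations. -/
lemma integral_prod_mul_eq [IsProbabilityMeasure ℙ] [IsProbabilityMeasure ℙ']
    (hX : ∀ t, Measurable[ℱ t] (X t)) (hX' : ∀ t, Measurable[ℱ' t] (X' t))
    {ν : ProbabilityMeasure E} (h0 : ∀ᵐ ω ∂ℙ, X 0 ω = ν) (h0' : ∀ᵐ ω ∂ℙ', X' 0 ω = ν)
    (hpred : ∀ p ∈ evalAlg D, ∀ s, ∃ q ∈ evalClosure D,
      Predicts ℱ ℙ X s p q ∧ Predicts ℱ' ℙ' X' s p q)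
    {φ : ℝ≥0 → ProbabilityMeasure E → ℝ} (hφ : ∀ t, φ t ∈ evalClosure D) (J : Finset ℝ≥0) :
    ∀ b : ℝ≥0, (∀ t ∈ J, t ≤ b) → ∀ ψ ∈ evalClosure D,
      ∫ ω, (∏ t ∈ J, φ t (X t ω)) * ψ (X b ω) ∂ℙ =
        ∫ ω, (∏ t ∈ J, φ t (X' t ω)) * ψ (X' b ω) ∂ℙ' := by
  have hm : ∀ t, Measurable (X t) := fun t => (hX t).mono (ℱ.le t) le_rfl
  have hm' : ∀ t, Measurable (X' t) := fun t => (hX' t).mono (ℱ'.le t) le_rfl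
  choose M hM using fun t => evalClosure_bounded (hφ t)
  have hprod : ∀ (J : Finset ℝ≥0) (μ : ℝ≥0 → ProbabilityMeasure E),
      |∏ t ∈ J, φ t (μ t)| ≤ ∏ t ∈ J, M t := fun J μ => by
    rw [Finset.abs_prod]
    exact Finset.prod_le_prod (fun t _ => abs_nonneg _) fun t _ => hM t _
  induction J using Finset.induction_on_max with
  | empty =>
    intro b _ ψ hψ
    simp only [Finset.prod_empty]
    refine integral_mul_eq_of_mem_evalClosure (C := 1) (hm b) (hm' b) measurable_const
      measurable_const (fun _ => by simp) (fun _ => by simp) (fun p hp => ?_) hψ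
    -- Condition all the way down to time `0`, where both processes equal `ν` almost surely.
    obtain ⟨q, hq, h, h'⟩ := hpred p hp b
    have e := h.integral_mul_eq (a := 0) hX (evalAlg_subset_evalClosure hp)
      (measurable_const (a := (1 : ℝ))) (C := 1) (fun _ => by simp)
    have e' := h'.integral_mul_eq (a := 0) hX' (evalAlg_subset_evalClosure hp)
      (measurable_const (a := (1 : ℝ))) (C := 1) (fun _ => by simp)
    rw [zero_add] at e e'
    rw [e, e']
    have c : ∫ ω, 1 * q (X 0 ω) ∂ℙ = q ν := by
      rw [integral_congr_ae (g := fun _ => q ν) (by filter_upwards [h0] with ω hω; simp [hω])]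
      simp
    have c' : ∫ ω, 1 * q (X' 0 ω) ∂ℙ' = q ν := by
      rw [integral_congr_ae (g := fun _ => q ν) (by filter_upwards [h0'] with ω hω; simp [hω])]
      simp
    rw [c, c']
  | insert a J hJ ih =>
    intro b hb ψ hψ
    have hab : a ≤ b := hb a (Finset.mem_insert_self a J)
    have haJ : a ∉ J := fun h => lt_irrefl a (hJ a h)
    have hle : ∀ t ∈ insert a J, t ≤ a := fun t ht => by
      rcases Finset.mem_insert.1 ht with rfl | h
      · exact le_rfl
      · exact (hJ t h).le
    have hG : Measurable[ℱ a] fun ω => ∏ t ∈ insert a J, φ t (X t ω) :=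
      Finset.measurable_fun_prod _ fun t ht =>
        (evalClosure_measurable (hφ t)).comp ((hX t).mono (ℱ.mono (hle t ht)) le_rfl)
    have hG' : Measurable[ℱ' a] fun ω => ∏ t ∈ insert a J, φ t (X' t ω) :=
      Finset.measurable_fun_prod _ fun t ht =>
        (evalClosure_measurable (hφ t)).comp ((hX' t).mono (ℱ'.mono (hle t ht)) le_rfl)
    refine integral_mul_eq_of_mem_evalClosure (hm b) (hm' b) (hG.mono (ℱ.le a) le_rfl)
      (hG'.mono (ℱ'.le a) le_rfl) (fun ω => hprod _ fun t => X t ω)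
      (fun ω => hprod _ fun t => X' t ω) (fun p hp => ?_) hψ
    obtain ⟨q, hq, h, h'⟩ := hpred p hp (b - a)
    have e := h.integral_mul_eq hX (evalAlg_subset_evalClosure hp) hG
      (fun ω => hprod _ fun t => X t ω)
    have e' := h'.integral_mul_eq hX' (evalAlg_subset_evalClosure hp) hG'
      (fun ω => hprod _ fun t => X' t ω)
    rw [add_tsub_cancel_of_le hab] at e e'
    rw [e, e']
    -- Conditioning at the largest time `a` turns `p(X_b)` into `q(X_a)`, which merges with the
    -- factor `φ a`.
    have := ih a (fun t ht => (hJ t ht).le) (φ a * q) (evalClosure_mul (hφ a) hq)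
    simp only [Finset.prod_insert haJ]
    simp only [Pi.mul_apply] at this
    convert! this using 3 <;> ring

end Prediction

/-! ### Finite-dimensional laws from product test functions -/

section Laws

/-- A finite measure on a finite product is determined by the integrals of products of bounded
continuous functions of the coordinates. -/
lemma ext_of_integral_prod_boundedContinuousFunction {ι : Type*} [Fintype ι]
    {μ ν : Measure (ι → ℝ)} [IsFiniteMeasure μ] [IsFiniteMeasure ν]
    (h : ∀ f : ι → (ℝ →ᵇ ℝ), ∫ x, ∏ i, f i (x i) ∂μ = ∫ x, ∏ i, f i (x i) ∂ν) : μ = ν := by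
  let e : (ι → ℝ) → (ι → ℝ) × (Empty → ℝ) := fun x => (x, default)
  have he : Measurable e := by fun_prop
  have key : μ.map e = ν.map e := by
    refine Measure.ext_of_integral_prod_mul_prod_boundedContinuousFunction fun f g => ?_
    have hm : Continuous fun p : (ι → ℝ) × (Empty → ℝ) =>
        (∏ i, f i (p.1 i)) * ∏ j, g j (p.2 j) := by fun_prop
    rw [integral_map he.aemeasurable hm.measurable.aestronglyMeasurable,
      integral_map he.aemeasurable hm.measurable.aestronglyMeasurable]
    simpa using h f
  have := congrArg (Measure.map Prod.fst) key
  rw [Measure.map_map measurable_fst he, Measure.map_map measurable_fst he] at this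
  simpa [e, Function.comp_def] using this

end Laws

/-! ### The σ-algebra of `M_1(E)` -/

section SigmaAlgebra

variable {E : Type*} [TopologicalSpace E] [PolishSpace E] [LocallyCompactSpace E]
  [MeasurableSpace E] [BorelSpace E]

lemma mem_CDelta_of_hasCompactSupport {f : E →ᵇ ℝ} (hf : HasCompactSupport f) : f ∈ CDelta E := by
  refine ⟨OnePoint.continuousMapMk f.toContinuousMap 0 ?_, fun x => rfl⟩
  exact tendsto_const_nhds.congr' (hasCompactSupport_iff_eventuallyEq.1 hf).symm

/-- A closed set is the countable union of its compact pieces. Compact sets are preferred as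
generators because their indicators are limits of compactly supported functions, which belong to
`C_Δ(E)`. -/
lemma borel_eq_generateFrom_isCompact [T2Space E] [SigmaCompactSpace E] :
    ‹MeasurableSpace E› = MeasurableSpace.generateFrom {K : Set E | IsCompact K} := by
  rw [BorelSpace.measurable_eq (α := E)]
  apply le_antisymm
  · rw [borel_eq_generateFrom_isClosed]
    refine MeasurableSpace.generateFrom_le fun F hF => ?_
    have : F = ⋃ n, F ∩ compactCovering E n := by
      rw [← inter_iUnion, iUnion_compactCovering, inter_univ]
    rw [this]
    exact MeasurableSet.iUnion fun n => MeasurableSpace.measurableSet_generateFrom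
      ((isCompact_compactCovering E n).inter_left hF)
  · exact MeasurableSpace.generateFrom_le fun K hK =>
      MeasurableSpace.measurableSet_generateFrom hK.isClosed.isOpen_compl |>.of_compl

variable {D : Submodule ℝ (E →ᵇ ℝ)}

lemma measurable_evalMap_comp_of_mem_closure {α : Type*} [MeasurableSpace α]
    {Y : α → ProbabilityMeasure E} (h : ∀ g ∈ D, Measurable fun a => evalMap g (Y a))
    {g : E →ᵇ ℝ} (hg : g ∈ D.topologicalClosure) : Measurable fun a => evalMap g (Y a) := by
  obtain ⟨s, hs, hlim⟩ := mem_closure_iff_seq_limit.1 hg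
  refine measurable_of_tendsto_metrizable (fun n => h (s n) (hs n)) (tendsto_pi_nhds.2 fun a => ?_)
  rw [tendsto_iff_dist_tendsto_zero] at hlim ⊢
  refine squeeze_zero (fun _ => dist_nonneg) (fun n => ?_) hlim
  rw [Real.dist_eq, dist_eq_norm, ← Pi.sub_apply, ← map_sub]
  exact abs_evalMap_le _ _

/-- The σ-algebra of `M_1(E)` is generated by the functions `⟨g, ·⟩`, `g ∈ D`. -/
lemma measurable_of_measurable_evalMap (hdense : CDelta E ≤ D.topologicalClosure) {α : Type*}
    [MeasurableSpace α] {Y : α → ProbabilityMeasure E}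
    (h : ∀ g ∈ D, Measurable fun a => evalMap g (Y a)) : Measurable Y := by
  refine Measurable.subtype_mk (f := fun a => (Y a : Measure E)) ?_
  refine Measurable.measure_of_isPiSystem_of_isProbabilityMeasure borel_eq_generateFrom_isCompact
    (fun K hK K' hK' _ => hK.inter hK') fun K hK => ?_
  let := TopologicalSpace.upgradeIsCompletelyMetrizable E
  -- As `K` is a `Gδ`, `f` can equal `1` exactly on `K`, so its powers converge to the indicator of
  -- `K`. The exponent `n + 1` keeps the support compact.
  obtain ⟨f, hfK, -, hfc, hf01⟩ := exists_continuous_one_zero_of_isCompact_of_isGδ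
    (t := ∅) hK hK.isClosed.isGδ isClosed_empty (disjoint_empty K)
  let F : ℕ → (E →ᵇ ℝ) := fun n =>
    BoundedContinuousFunction.ofNormedAddCommGroup (fun x => f x ^ (n + 1)) (by fun_prop) 1
      fun x => by
        rw [norm_pow, Real.norm_eq_abs, abs_of_nonneg (hf01 x).1]
        exact pow_le_one₀ (hf01 x).1 (hf01 x).2
  have hF : ∀ n, Measurable fun a => evalMap (F n) (Y a) := fun n => by
    refine measurable_evalMap_comp_of_mem_closure h (hdense (mem_CDelta_of_hasCompactSupport ?_))
    exact hfc.mono' fun x hx => subset_tsupport _ fun h0 => hx (by simp [F, h0])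
  have hreal : Measurable fun a => (Y a : Measure E).real K := by
    refine measurable_of_tendsto_metrizable hF (tendsto_pi_nhds.2 fun a => ?_)
    rw [← integral_indicator_one hK.measurableSet]
    refine tendsto_integral_of_dominated_convergence (fun _ => 1)
      (fun n => (F n).continuous.measurable.aestronglyMeasurable) (integrable_const _)
      (fun n => Eventually.of_forall fun x => ?_) (Eventually.of_forall fun x => ?_)
    · change ‖f x ^ (n + 1)‖ ≤ 1
      rw [norm_pow, Real.norm_eq_abs, abs_of_nonneg (hf01 x).1]
      exact pow_le_one₀ (hf01 x).1 (hf01 x).2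
    · change Tendsto (fun n => f x ^ (n + 1)) atTop _
      by_cases hx : x ∈ K
      · have : f x = 1 := by rwa [hfK] at hx
        simp [this, hx]
      · have : f x ≠ 1 := fun h1 => hx (by rw [hfK]; exact h1)
        rw [indicator_of_notMem hx]
        exact (tendsto_pow_atTop_nhds_zero_of_lt_one (hf01 x).1
          (lt_of_le_of_ne (hf01 x).2 this)).comp (tendsto_add_atTop_nat 1)
  simpa [measureReal_def, ENNReal.ofReal_toReal] using hreal.ennreal_ofReal

end SigmaAlgebra

/-! ### Uniqueness in law -/

section Uniqueness

variable {E : Type*} [TopologicalSpace E] [PolishSpace E] [LocallyCompactSpace E]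
  [MeasurableSpace E] [BorelSpace E] {D : Submodule ℝ (E →ᵇ ℝ)}
variable {Ω : Type*} {mΩ : MeasurableSpace Ω} {ℱ : Filtration ℝ≥0 mΩ} {ℙ : Measure Ω}
  {X : ℝ≥0 → Ω → ProbabilityMeasure E}
variable {Ω' : Type*} {mΩ' : MeasurableSpace Ω'} {ℱ' : Filtration ℝ≥0 mΩ'} {ℙ' : Measure Ω'}
  {X' : ℝ≥0 → Ω' → ProbabilityMeasure E}

lemma processLaw_eq_of_integral_prod_eq (hdense : CDelta E ≤ D.topologicalClosure)
    [IsProbabilityMeasure ℙ] [IsProbabilityMeasure ℙ'] (hX : ∀ t, Measurable (X t))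
    (hX' : ∀ t, Measurable (X' t))
    (h : ∀ φ : ℝ≥0 → ProbabilityMeasure E → ℝ, (∀ t, φ t ∈ evalClosure D) → ∀ J : Finset ℝ≥0,
      ∫ ω, ∏ t ∈ J, φ t (X t ω) ∂ℙ = ∫ ω, ∏ t ∈ J, φ t (X' t ω) ∂ℙ') :
    processLaw ℙ' X' = processLaw ℙ X := by
  let Φ : (ℝ≥0 → ProbabilityMeasure E) → (ℝ≥0 × D → ℝ) := fun x i => evalMap (i.2 : E →ᵇ ℝ) (x i.1)
  have hΦ : Measurable Φ :=
    measurable_pi_iff.2 fun i => (measurable_evalMap _).comp (measurable_pi_apply _)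
  have hXm : Measurable fun ω t => X t ω := measurable_pi_iff.2 hX
  have hXm' : Measurable fun ω t => X' t ω := measurable_pi_iff.2 hX'
  have : IsProbabilityMeasure (processLaw ℙ X) := Measure.isProbabilityMeasure_map hXm.aemeasurable
  have : IsProbabilityMeasure (processLaw ℙ' X') :=
    Measure.isProbabilityMeasure_map hXm'.aemeasurable
  have hfin : ∀ I : Finset (ℝ≥0 × D), ((processLaw ℙ' X').map Φ).map I.restrict =
      ((processLaw ℙ X).map Φ).map I.restrict := by
    intro I
    have hI : Measurable (I.restrict (π := fun _ => ℝ)) := Finset.measurable_restrict I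
    rw [processLaw, processLaw, Measure.map_map hΦ hXm, Measure.map_map hΦ hXm',
      Measure.map_map hI (hΦ.comp hXm), Measure.map_map hI (hΦ.comp hXm')]
    have hm := hI.comp (hΦ.comp hXm)
    have hm' := hI.comp (hΦ.comp hXm')
    have := Measure.isProbabilityMeasure_map (μ := ℙ) hm.aemeasurable
    have := Measure.isProbabilityMeasure_map (μ := ℙ') hm'.aemeasurable
    refine ext_of_integral_prod_boundedContinuousFunction fun f => ?_
    have hfc : Continuous fun x : I → ℝ => ∏ i, f i (x i) := by fun_prop
    rw [integral_map hm.aemeasurable hfc.measurable.aestronglyMeasurable,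
      integral_map hm'.aemeasurable hfc.measurable.aestronglyMeasurable]
    classical
    -- Factors of `I` sharing a time are grouped into one function of `X_t`.
    let φ : ℝ≥0 → ProbabilityMeasure E → ℝ := fun t =>
      ∏ i ∈ Finset.univ.filter fun i : I => (i : ℝ≥0 × D).1 = t,
        fun μ => f i (evalMap (i : ℝ≥0 × D).2.1 μ)
    have hφ : ∀ t, φ t ∈ evalClosure D := fun t =>
      evalClosure_prod _ fun i _ => evalClosure_comp (f i).continuous (i : ℝ≥0 × D).2.2
    have hprod : ∀ x : ℝ≥0 → ProbabilityMeasure E,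
        ∏ i : I, f i (Φ x i) = ∏ t ∈ I.image Prod.fst, φ t (x t) := by
      intro x
      rw [← Finset.prod_fiberwise_of_maps_to (s := Finset.univ) (t := I.image Prod.fst)
        (g := fun i : I => (i : ℝ≥0 × D).1)
        (fun i _ => Finset.mem_image_of_mem _ i.2)]
      refine Finset.prod_congr rfl fun t _ => ?_
      simp only [φ, Finset.prod_apply]
      refine Finset.prod_congr rfl fun i hi => ?_
      rw [← (Finset.mem_filter.1 hi).2]
    have := h φ hφ (I.image Prod.fst)
    simp only [← hprod] at this
    exact this.symm
  have hmap : (processLaw ℙ' X').map Φ = (processLaw ℙ X).map Φ := by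
    have := Measure.isProbabilityMeasure_map (μ := processLaw ℙ X) hΦ.aemeasurable
    have hP : ∀ I : Finset (ℝ≥0 × D),
        IsProbabilityMeasure (((processLaw ℙ X).map Φ).map I.restrict) := fun I =>
      Measure.isProbabilityMeasure_map (Finset.measurable_restrict I).aemeasurable
    exact IsProjectiveLimit.unique
      (P := fun I : Finset (ℝ≥0 × D) => ((processLaw ℙ X).map Φ).map I.restrict)
      hfin fun I => rfl
  -- Every measurable set of paths is a preimage under `Φ`, so equality of the image laws gives
  -- equality of the laws.
  have hle : (MeasurableSpace.pi : MeasurableSpace (ℝ≥0 → ProbabilityMeasure E)) ≤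
      MeasurableSpace.comap Φ MeasurableSpace.pi := by
    let m := MeasurableSpace.comap Φ MeasurableSpace.pi
    have : Measurable[m, MeasurableSpace.pi] (id : (ℝ≥0 → ProbabilityMeasure E) → _) := by
      refine measurable_pi_iff.2 fun t => measurable_of_measurable_evalMap hdense fun g hg => ?_
      exact (measurable_pi_apply ((t, ⟨g, hg⟩) : ℝ≥0 × D)).comp (comap_measurable Φ)
    exact fun S hS => this hS
  refine Measure.ext fun S hS => ?_
  obtain ⟨T, hT, rfl⟩ := hle S hS
  rw [← Measure.map_apply hΦ hT, ← Measure.map_apply hΦ hT, hmap]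

lemma fst_mem_closure_tensorPow {L : PolyD D →ₗ[ℝ] MPoly E} {k : ℕ}
    {z : ((Fin k → E) →ᵇ ℝ) × ((Fin k → E) →ᵇ ℝ)}
    (hz : z ∈ closure (dualGraph D L k : Set (((Fin k → E) →ᵇ ℝ) × ((Fin k → E) →ᵇ ℝ)))) :
    z.1 ∈ closure (tensorPow D k : Set ((Fin k → E) →ᵇ ℝ)) :=
  map_mem_closure continuous_fst hz fun _ hw => hw.1

lemma predicts_of_momentFormula {L : PolyD D →ₗ[ℝ] MPoly E} (hE : Nonempty E)
    (hone : (1 : E →ᵇ ℝ) ∈ D)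
    (hclosable : ∀ k : ℕ, 1 ≤ k → (dualOp D L k).IsClosable)
    {u : ∀ k : ℕ, ((Fin k → E) →ᵇ ℝ) → ℝ≥0 → ((Fin k → E) →ᵇ ℝ)}
    (hu : ∀ k : ℕ, 1 ≤ k → ∀ g ∈ tensorPow D k, SolvesPIDE (dualOp D L k).closure g (u k g))
    [IsProbabilityMeasure ℙ] [IsProbabilityMeasure ℙ']
    (hX : ∀ t, Measurable[ℱ t] (X t)) (hX' : ∀ t, Measurable[ℱ' t] (X' t))
    (hm : ∀ k : ℕ, 1 ≤ k → ∀ g ∈ tensorPow D k, MomentFormula ℱ ℙ X g (u k g))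
    (hm' : ∀ k : ℕ, 1 ≤ k → ∀ g ∈ tensorPow D k, MomentFormula ℱ' ℙ' X' g (u k g))
    {p : ProbabilityMeasure E → ℝ} (hp : p ∈ evalAlg D) (s : ℝ≥0) :
    ∃ q ∈ evalClosure D, Predicts ℱ ℙ X s p q ∧ Predicts ℱ' ℙ' X' s p q := by
  have hpow := adjoin_le_span_pow (V := D.map evalMap) ⟨1, hone, evalMap_one⟩ hp
  -- Membership of `p` is carried along to have integrability when predictions are added.
  suffices p ∈ evalClosure D ∧
      ∃ q ∈ evalClosure D, Predicts ℱ ℙ X s p q ∧ Predicts ℱ' ℙ' X' s p q from this.2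
  clear hp
  induction hpow using Submodule.span_induction with
  | mem p hp =>
    obtain ⟨k, hk, _, ⟨g, hg, rfl⟩, rfl⟩ := hp
    have hpair : ∀ μ, pairing (powTensor g k) μ = (evalMap g ^ k) μ :=
      pairing_of_eq_prod (powTensor_apply g k)
    have hT := powTensor_mem hg k
    refine ⟨evalAlg_subset_evalClosure (pow_mem (evalMap_mem_evalAlg hg) k),
      pairing (u k (powTensor g k) s), pairing_mem_evalClosure ?_, fun t => ?_, fun t => ?_⟩
    · have := mem_closure_dualGraph D L k hE (hclosable k hk)
        ⟨u k (powTensor g k) s, (hu k hk _ hT).mem_domain s⟩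
      exact fst_mem_closure_tensorPow this
    · have := hm k hk _ hT t (t + s) (le_add_of_nonneg_right zero_le)
      simpa only [hpair, add_tsub_cancel_left] using this
    · have := hm' k hk _ hT t (t + s) (le_add_of_nonneg_right zero_le)
      simpa only [hpair, add_tsub_cancel_left] using this
  | zero =>
    have h0 := evalAlg_subset_evalClosure (zero_mem (evalAlg D))
    refine ⟨h0, 0, h0, fun t => ?_, fun t => ?_⟩
    · exact (condExp_zero (μ := ℙ) (m := ℱ t)).eventuallyEq
    · exact (condExp_zero (μ := ℙ') (m := ℱ' t)).eventuallyEq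
  | add p p' _ _ h h' =>
    obtain ⟨hp, q, hq, h1, h2⟩ := h
    obtain ⟨hp', q', hq', h1', h2'⟩ := h'
    exact ⟨evalClosure_add hp hp', q + q', evalClosure_add hq hq', h1.add hX hp hp' h1',
      h2.add hX' hp hp' h2'⟩
  | smul c p _ h =>
    obtain ⟨hp, q, hq, h1, h2⟩ := h
    exact ⟨evalClosure_smul c hp, c • q, evalClosure_smul c hq, h1.smul c, h2.smul c⟩

theorem processLaw_eq_of_momentFormula {L : PolyD D →ₗ[ℝ] MPoly E} {ν : ProbabilityMeasure E}
    (hdense : CDelta E ≤ D.topologicalClosure) (hone : (1 : E →ᵇ ℝ) ∈ D)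
    (hclosable : ∀ k : ℕ, 1 ≤ k → (dualOp D L k).IsClosable)
    {u : ∀ k : ℕ, ((Fin k → E) →ᵇ ℝ) → ℝ≥0 → ((Fin k → E) →ᵇ ℝ)}
    (hu : ∀ k : ℕ, 1 ≤ k → ∀ g ∈ tensorPow D k, SolvesPIDE (dualOp D L k).closure g (u k g))
    [IsProbabilityMeasure ℙ] [IsProbabilityMeasure ℙ']
    (hX : IsSolution D L ν ℱ ℙ X) (hX' : IsSolution D L ν ℱ' ℙ' X')
    (hm : ∀ k : ℕ, 1 ≤ k → ∀ g ∈ tensorPow D k, MomentFormula ℱ ℙ X g (u k g))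
    (hm' : ∀ k : ℕ, 1 ≤ k → ∀ g ∈ tensorPow D k, MomentFormula ℱ' ℙ' X' g (u k g)) :
    processLaw ℙ' X' = processLaw ℙ X := by
  refine processLaw_eq_of_integral_prod_eq hdense hX.measurable hX'.measurable fun φ hφ J => ?_
  -- Taking the last time of `J` and the constant `1` as final factor leaves the bare product.
  have := integral_prod_mul_eq hX.adapted hX'.adapted hX.initial hX'.initial
    (fun p hp s => predicts_of_momentFormula ν.nonempty hone hclosable hu hX.adapted hX'.adapted
      hm hm' hp s) hφ J (J.sup id) (fun t ht => Finset.le_sup (f := id) ht) 1 evalClosure_one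
  simpa using this

end Uniqueness

end PolyDiff

theorem mainTheorem8
    {E : Type*} [TopologicalSpace E] [PolishSpace E] [LocallyCompactSpace E]
    [MeasurableSpace E] [BorelSpace E]
    (D : Submodule ℝ (E →ᵇ ℝ)) (hD : D ≤ CDelta E) (hdense : CDelta E ≤ D.topologicalClosure)
    (hone : (1 : E →ᵇ ℝ) ∈ D)
    (L : PolyD D →ₗ[ℝ] MPoly E) (hL : HasPolynomialForm D L)
    (ν : ProbabilityMeasure E)
    {Ω : Type*} {mΩ : MeasurableSpace Ω} (ℙ : Measure Ω) [IsProbabilityMeasure ℙ]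
    (ℱ : Filtration ℝ≥0 mΩ) (X : ℝ≥0 → Ω → ProbabilityMeasure E)
    (hX : IsSolution D L ν ℱ ℙ X) (hXcont : ∀ ω, Continuous fun t => X t ω)
    (hclosable : ∀ k : ℕ, 1 ≤ k → (dualOp D L k).IsClosable)
    (u : ∀ k : ℕ, ((Fin k → E) →ᵇ ℝ) → ℝ≥0 → ((Fin k → E) →ᵇ ℝ))
    (hu : ∀ k : ℕ, 1 ≤ k → ∀ g ∈ tensorPow D k, SolvesPIDE (dualOp D L k).closure g (u k g))
    (hmoment : ∀ k : ℕ, 1 ≤ k → ∀ g ∈ tensorPow D k, MomentFormula ℱ ℙ X g (u k g)) :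
    -- any other solution for which the moment formula holds has the law of `X`
    (∀ {Ω' : Type*} {mΩ' : MeasurableSpace Ω'} (ℙ' : Measure Ω') [IsProbabilityMeasure ℙ']
      (ℱ' : Filtration ℝ≥0 mΩ') (X' : ℝ≥0 → Ω' → ProbabilityMeasure E),
      IsSolution D L ν ℱ' ℙ' X' →
      (∀ k : ℕ, 1 ≤ k → ∀ g ∈ tensorPow D k, MomentFormula ℱ' ℙ' X' g (u k g)) →
      processLaw ℙ' X' = processLaw ℙ X) ∧
    -- under the bound on `L̄_k u_g` that makes the moment formula hold for all solutions,
    -- any other solution whatsoever has the law of `X`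
    ((∀ k : ℕ, 1 ≤ k → ∀ g ∈ tensorPow D k,
        LocallyBoundedImage (dualOp D L k).closure (u k g)) →
      ∀ {Ω' : Type*} {mΩ' : MeasurableSpace Ω'} (ℙ' : Measure Ω') [IsProbabilityMeasure ℙ']
        (ℱ' : Filtration ℝ≥0 mΩ') (X' : ℝ≥0 → Ω' → ProbabilityMeasure E),
        IsSolution D L ν ℱ' ℙ' X' →
        processLaw ℙ' X' = processLaw ℙ X) := by
  refine ⟨fun ℙ' _ ℱ' X' hX' hm' => ?_, fun hb Ω' mΩ' ℙ' _ ℱ' X' hX' => ?_⟩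
  · exact processLaw_eq_of_momentFormula hdense hone hclosable hu hX hX' hmoment hm'
  · exact processLaw_eq_of_momentFormula hdense hone hclosable hu hX hX' hmoment
      fun k hk g hg => hX'.momentFormula (hclosable k hk) (hu k hk g hg) (hb k hk g hg)
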